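/- Let $p\le q$ be coprime positive integers and let $\kappa,\mu>0$. Put $g(x)=\frac pq x-v_0x^2$ with $v_0=\frac{\kappa(p^2+q^2)^{3/2}}{2q^3}$, so that the graph of $g$ has slope $p/q$ and curvature $\kappa$ at the origin. Let $\Omega\subset\mathbb R^2$ be a set which, in some square $(-c_0,c_0)^2$ with $c_0>0$, is the region below the graph of $g$ (points on the graph itself may or may not belong to $\Omega$). For $h>0$ let $\tau=\mu h$, and let $w^{m,n}(t)$, $(m,n)\in\mathbb Z^2$, $0\le t\le\tau$, be the bounded solution of the semi-discrete heat equation $$\frac{d}{dt}w^{m,n}=\frac1{h^2}\bigl(w^{m+1,n}+w^{m-1,n}+w^{m,n+1}+w^{m,n-1}-4w^{m,n}\bigr),$$ with $w^{m,n}(0)=1$ if $(mh,nh)\in\Omega$ and $w^{m,n}(0)=0$ otherwise. Let $S=\{(s,j)\in\mathbb Z^2: 0\le s\le q-1,\ j<\frac pq s\}$, and let $(s_1,j_1),(s_2,j_2),\dots$ be the enumeration of $S$ for which the distances $d_i=\frac{|j_iq-s_ip|}{\sqrt{p^2+q^2}}$ to the line $y=\frac pq x$ satisfy $0<d_1<d_2<\cdots$;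 put $(s_0,j_0)=(0,0)$ and $d_0=0$. For $n\ge0$ let $$L_n=\frac12\int_0^{\sqrt{2d_n/(\mu\kappa)}}e^{-x^2/4}\,dx+\sum_{i=1}^{n-1}\int_0^{\sqrt{2d_i/(\mu\kappa)}}e^{-x^2/4}\,dx,$$ $$R_n=\frac12\int_{\sqrt{2d_n/(\mu\kappa)}}^\infty e^{-x^2/4}\,dx+\sum_{i=n+1}^{\infty}\int_{\sqrt{2d_i/(\mu\kappa)}}^\infty e^{-x^2/4}\,dx ,$$ where the series converges. Fix an integer $n_0\ge0$. Then for all sufficiently small $h>0$ (equivalently, all sufficiently small $\tau=\mu h$) the following hold. (a) If $w^{s_{n_0},j_{n_0}}(\tau)\le\frac12$, then $L_{n_0}\le R_{n_0}$. Moreover, unless $L_{n_0}=R_{n_0}$, one has $w^{s_{n_0},j_{n_0}}(\tau)\le\frac12$ if and only if $L_{n_0}\le R_{n_0}$. (b) If $w^{s_{n_0},j_{n_0}}(\tau)=\frac12$, then $L_{n_0}=R_{n_0}$. In this case $d_{n_0}h$ is the normal displacement of the interface point at the origin at time $\tau$, and $\frac{d_{n_0}}{\mu}$ is its normal velocity.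 Here the normal displacement is the distance from $(s_nh,j_nh)$ to the line $y=\frac pqx$, where $n\ge0$ is the index with $w^{s_i,j_i}(\tau)\le\frac12$ for all $0\le i\le n$ and $w^{s_{n+1},j_{n+1}}(\tau)>\frac12$, and the normal velocity is the normal displacement divided by $\tau$. -/

import Mathlib

open scoped Topology
open Filter Set

noncomputable section

namespace AnisoThreshold

/-- The Euclidean plane. -/
abbrev Plane := EuclideanSpace ℝ (Fin 2)

/-- The physical position `(m h, n h)` of the lattice point with index `(m, n)`. -/
def gridPoint (h : ℝ) (z : ℤ × ℤ) : Plane := !₂[(z.1 : ℝ) * h, (z.2 : ℝ) * h]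

/-- Indices of the lattice points lying in `Ω`. -/
def latticeSet (Ω : Set Plane) (h : ℝ) : Set (ℤ × ℤ) := {z | gridPoint h z ∈ Ω}

/-- The `0`-`1` initial datum of the scheme: the indicator of the lattice points in `Ω`. -/
def initialDatum (Ω : Set Plane) (h : ℝ) : ℤ × ℤ → ℝ :=
  (latticeSet Ω h).indicator (fun _ => 1)

/-- The five-point discrete Laplacian on the grid of mesh size `h`. -/
def discreteLaplacian (h : ℝ) (v : ℤ × ℤ → ℝ) (z : ℤ × ℤ) : ℝ :=
  1 / h ^ 2 * (v (z.1 + 1, z.2) + v (z.1 - 1, z.2) + v (z.1, z.2 + 1) + v (z.1, z.2 - 1)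
    - 4 * v z)

/-- `w` is the bounded solution, on the time interval `[0, τ]`, of the semi-discrete heat equation
with initial value `u`. (Boundedness singles out the solution given by the heat semigroup.) -/
structure IsHeatSolution (h τ : ℝ) (u : ℤ × ℤ → ℝ) (w : ℝ → ℤ × ℤ → ℝ) : Prop where
  initial : ∀ z, w 0 z = u z
  continuousOn : ∀ z, ContinuousOn (fun t => w t z) (Icc 0 τ)
  equation : ∀ t ∈ Ioc 0 τ, ∀ z,
    HasDerivWithinAt (fun r => w r z) (discreteLaplacian h (w t) z) (Icc 0 τ) t
  bounded : ∃ C : ℝ, ∀ t ∈ Icc 0 τ, ∀ z, |w t z| ≤ C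

/-- The parabola through the origin with slope `p / q` and curvature `κ` there. -/
def boundaryGraph (p q : ℕ) (κ x : ℝ) : ℝ :=
  (p : ℝ) / q * x
    - κ * ((q : ℝ) ^ 2 + (p : ℝ) ^ 2) ^ (3 / 2 : ℝ) / (2 * (q : ℝ) ^ 3) * x ^ 2

/-- In a square around the origin, `Ω` is the region below the graph of `boundaryGraph`. Nothing is
prescribed on the graph itself, so that `Ω` may be open as well as closed. -/
def HasLocalBoundary (Ω : Set Plane) (p q : ℕ) (κ : ℝ) : Prop :=
  ∃ c₀ : ℝ, 0 < c₀ ∧ ∀ x y : ℝ, |x| < c₀ → |y| < c₀ →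
    (y < boundaryGraph p q κ x → !₂[x, y] ∈ Ω) ∧
    (boundaryGraph p q κ x < y → !₂[x, y] ∉ Ω)

/-- The strip of lattice points `(s, j)` with `0 ≤ s ≤ q - 1` and `j < (p / q) s`. -/
def strip (p q : ℕ) : Set (ℤ × ℤ) :=
  {z | 0 ≤ z.1 ∧ z.1 ≤ (q : ℤ) - 1 ∧ (z.2 : ℝ) < (p : ℝ) / q * z.1}

/-- The distance from `(s, j)` to the line `y = (p / q) x`. -/
def lineDist (p q : ℕ) (z : ℤ × ℤ) : ℝ :=
  |(z.2 : ℝ) * q - (z.1 : ℝ) * p| / √((p : ℝ) ^ 2 + (q : ℝ) ^ 2)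

/-- `P 1, P 2, P 3, …` lists every point of the strip exactly once, by strictly increasing distance
to the line `y = (p / q) x`; the index `0` stands for the interface point, the origin. -/
structure IsStripOrdering (p q : ℕ) (P : ℕ → ℤ × ℤ) : Prop where
  zero : P 0 = (0, 0)
  bijOn : BijOn P (Ici 1) (strip p q)
  strictMonoOn : StrictMonoOn (fun i => lineDist p q (P i)) (Ici 1)

/-- `√(2 d / (μ κ))`. -/
def gaussLimit (μ κ d : ℝ) : ℝ := √(2 * d / (μ * κ))

/-- `∫_0^{√(2 d / (μ κ))} exp (-x² / 4) dx`. -/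
def gaussInner (μ κ d : ℝ) : ℝ := ∫ x in (0 : ℝ)..gaussLimit μ κ d, Real.exp (-x ^ 2 / 4)

/-- `∫_{√(2 d / (μ κ))}^∞ exp (-x² / 4) dx`. -/
def gaussOuter (μ κ d : ℝ) : ℝ := ∫ x in Ioi (gaussLimit μ κ d), Real.exp (-x ^ 2 / 4)

/-- The left-hand side of the criterion, for distances `d 0, d 1, d 2, …`. -/
def innerSum (μ κ : ℝ) (d : ℕ → ℝ) (n : ℕ) : ℝ :=
  1 / 2 * gaussInner μ κ (d n) + ∑ i ∈ Finset.Ico 1 n, gaussInner μ κ (d i)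

/-- The right-hand side of the criterion; the series runs over all indices `i ≥ n + 1`. -/
def outerSum (μ κ : ℝ) (d : ℕ → ℝ) (n : ℕ) : ℝ :=
  1 / 2 * gaussOuter μ κ (d n) + ∑' k : ℕ, gaussOuter μ κ (d (n + 1 + k))

/-- The line `y = (p / q) x`, tangent to the interface at the origin. -/
def tangentLine (p q : ℕ) : Set Plane := {z | z 1 = (p : ℝ) / q * z 0}

/-- `D` is the normal displacement of the interface point at the origin after one time step that
ends with the diffused values `W`: running through the ordered strip, the first passage from values
`≤ 1 / 2` to a value `> 1 / 2` takes place right after the index `n`, and `D` is the distance of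
the corresponding grid point to the tangent line. -/
def IsNormalDisplacement (p q : ℕ) (P : ℕ → ℤ × ℤ) (h : ℝ) (W : ℤ × ℤ → ℝ) (D : ℝ) : Prop :=
  ∃ n : ℕ, (∀ i ≤ n, W (P i) ≤ 1 / 2) ∧ 1 / 2 < W (P (n + 1)) ∧
    D = Metric.infDist (gridPoint h (P n)) (tangentLine p q)

/-- `V` is the normal velocity: normal displacement divided by the length `τ` of the time step. -/
def IsNormalVelocity (p q : ℕ) (P : ℕ → ℤ × ℤ) (h τ : ℝ) (W : ℤ × ℤ → ℝ) (V : ℝ) : Prop :=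
  ∃ D : ℝ, IsNormalDisplacement p q P h W D ∧ V = D / τ

end AnisoThreshold

end

/-! ### The one-dimensional lattice heat kernel: evolution equation and moment identities. -/

noncomputable section LatticeKernel

open Real MeasureTheory

/-! Put t = μ/h and ℓ = √(p² + q²). After rescaling time, every bounded solution at time τ is the
heat semigroup of the unit lattice at time t applied to the datum (`eq_heatSemigroup`), and t → ∞ as
h → 0. Let z₀ lie on the lattice line of index n parallel to the tangent. Compare the datum with the
half plane below that line, given the value 1/2 on the line itself: by reflection in z₀ the
semigroup takes this half plane to exactly 1/2 at z₀ (`tsum_planeHeatKernel_mul_heaviside`). Hence w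
− 1/2 is the heat flow of the difference of the two data, up to a far-field error controlled by
`exists_planeHeatKernel_tail_bound`.

At diffusive position y√t·(q,p) the parabola has fallen below the tangent by about a·y² lattice
lines, a = κμℓ³/2, so the defect occupies finitely many lines for each y. By the local limit theorem
(`tendsto_sqrt_mul_heatKernel`) the planar kernel on each such line is about t⁻¹(4π)⁻¹exp(−ℓ²y²/4).
Dominated convergence, based on `exists_heatKernel_scaled_decay`, then gives the limit of √t(w −
1/2) (`tendsto_sqrt_mul_heatSemigroup_sub_half`). A line k < n contributes an inner Gaussian
integral, a line k > n minus an outer one, and k = n half of each; the limit is (2πℓ)⁻¹(L_n − R_n)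
(`integral_sum_limitDefect`).

The sign of L_n − R_n therefore decides the threshold test for small h. If it vanishes, the
first-order term says nothing at index n, but L_n − R_n is strictly increasing in n
(`innerSum_sub_outerSum_strictMono`), which fixes the test at all smaller indices and at n + 1, and
so the displacement. -/

/-- The heat kernel of the nearest-neighbour Laplacian on `ℤ`, as a Fourier integral. -/
def heatKernel (t : ℝ) (m : ℤ) : ℝ :=
  (2 * π)⁻¹ * ∫ θ in (-π)..π, exp (-2 * t * (1 - cos θ)) * cos (m * θ)

lemma heatKernel_neg (t : ℝ) (m : ℤ) : heatKernel t (-m) = heatKernel t m := by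
  simp [heatKernel]

lemma intervalIntegrable_heatKernel (t : ℝ) (m : ℤ) (a b : ℝ) :
    IntervalIntegrable (fun θ => exp (-2 * t * (1 - cos θ)) * cos (m * θ)) volume a b :=
  Continuous.intervalIntegrable (by fun_prop) _ _

lemma integral_cos_intCast_mul (m : ℤ) :
    ∫ θ in (-π)..π, cos (m * θ) = if m = 0 then 2 * π else 0 := by
  split_ifs with h
  · simp [h]; ring
  · have hm : (m : ℝ) ≠ 0 := by exact_mod_cast h
    rw [intervalIntegral.integral_comp_mul_left _ hm, integral_cos]
    simp

lemma heatKernel_zero (m : ℤ) : heatKernel 0 m = if m = 0 then 1 else 0 := by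
  have := pi_pos
  simp only [heatKernel, mul_zero, zero_mul, exp_zero, one_mul]
  rw [integral_cos_intCast_mul]
  split_ifs
  · field_simp
  · simp

lemma exp_neg_mul_one_sub_cos_le {T t : ℝ} (ht : |t| ≤ T) (θ : ℝ) :
    exp (-2 * t * (1 - cos θ)) ≤ exp (4 * T) := by
  apply exp_le_exp.2
  have h1 := cos_le_one θ
  have h2 := neg_one_le_cos θ
  have h3 := abs_le.1 ht
  nlinarith

lemma hasDerivAt_heatKernel (t : ℝ) (m : ℤ) :
    HasDerivAt (fun s => heatKernel s m)
      (heatKernel t (m + 1) + heatKernel t (m - 1) - 2 * heatKernel t m) t := by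
  have key := (intervalIntegral.hasDerivAt_integral_of_dominated_loc_of_deriv_le
    (μ := volume) (a := -π) (b := π) (x₀ := t) (s := Metric.ball t 1)
    (F := fun s θ => exp (-2 * s * (1 - cos θ)) * cos (m * θ))
    (F' := fun s θ => exp (-2 * s * (1 - cos θ)) * (-2 * (1 - cos θ)) * cos (m * θ))
    (bound := fun _ => exp (4 * (|t| + 1)) * 4) (Metric.ball_mem_nhds t one_pos)
    (Eventually.of_forall fun s => Continuous.aestronglyMeasurable (by fun_prop))
    (intervalIntegrable_heatKernel t m _ _)
    (Continuous.aestronglyMeasurable (by fun_prop))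
    (ae_of_all _ fun θ _ s hs => by
      have h1 := cos_le_one θ
      have h2 := neg_one_le_cos θ
      have hs' : |s| ≤ |t| + 1 := by
        rw [Metric.mem_ball, Real.dist_eq] at hs
        have := abs_add_le (s - t) t
        rw [sub_add_cancel] at this
        linarith
      rw [norm_mul, norm_mul, Real.norm_eq_abs, Real.norm_eq_abs, Real.norm_eq_abs, abs_exp]
      have h3 : |-2 * (1 - cos θ)| ≤ 4 := by rw [abs_le]; constructor <;> linarith
      exact (mul_le_mul (mul_le_mul (exp_neg_mul_one_sub_cos_le hs' θ) h3 (abs_nonneg _)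
        (exp_pos _).le) (abs_cos_le_one _) (abs_nonneg _) (by positivity)).trans (mul_one _).le)
    (by simp)
    (ae_of_all _ fun θ _ s _ => by
      have h : HasDerivAt (fun s : ℝ => -2 * s * (1 - cos θ)) (-2 * (1 - cos θ)) s := by
        simpa using ((hasDerivAt_id s).const_mul (-2)).mul_const (1 - cos θ)
      exact (h.exp.mul_const _))).2
  refine (key.const_mul (2 * π)⁻¹).congr_deriv ?_
  simp only [heatKernel]
  symm
  rw [← mul_add, mul_left_comm, ← mul_sub,
    ← intervalIntegral.integral_add (intervalIntegrable_heatKernel t _ _ _)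
      (intervalIntegrable_heatKernel t _ _ _),
    ← intervalIntegral.integral_const_mul, ← intervalIntegral.integral_sub
      ((intervalIntegrable_heatKernel t _ _ _).add (intervalIntegrable_heatKernel t _ _ _))
      ((intervalIntegrable_heatKernel t _ _ _).const_mul _)]
  congr 1
  apply intervalIntegral.integral_congr
  intro θ _
  simp only
  push_cast
  rw [add_mul, sub_mul, one_mul, cos_add, cos_sub]
  ring

/-- Integration by parts in the Fourier integral. -/
lemma intCast_mul_heatKernel (t : ℝ) (m : ℤ) :
    m * heatKernel t m = t * (heatKernel t (m - 1) - heatKernel t (m + 1)) := by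
  have hd : ∀ θ : ℝ, HasDerivAt (fun θ => exp (-2 * t * (1 - cos θ)) * sin (m * θ))
      (m * (exp (-2 * t * (1 - cos θ)) * cos (m * θ)) -
        t * (exp (-2 * t * (1 - cos θ)) * cos ((m - 1 : ℤ) * θ) -
          exp (-2 * t * (1 - cos θ)) * cos ((m + 1 : ℤ) * θ))) θ := by
    intro θ
    have h1 : HasDerivAt (fun θ : ℝ => -2 * t * (1 - cos θ)) (-2 * t * sin θ) θ := by
      simpa using ((hasDerivAt_cos θ).const_sub 1).const_mul (-2 * t)
    have h2 : HasDerivAt (fun θ : ℝ => sin (m * θ)) (cos (m * θ) * m) θ := by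
      simpa using ((hasDerivAt_id θ).const_mul (m : ℝ)).sin
    refine (h1.exp.mul h2).congr_deriv ?_
    push_cast
    rw [add_mul, sub_mul, one_mul, cos_add, cos_sub]
    ring
  have := intervalIntegral.integral_eq_sub_of_hasDerivAt (a := -π) (b := π) (fun θ _ => hd θ)
    (Continuous.intervalIntegrable (by fun_prop) _ _)
  rw [intervalIntegral.integral_sub, intervalIntegral.integral_const_mul,
    intervalIntegral.integral_const_mul, intervalIntegral.integral_sub] at this
  · have e : sin ((m : ℝ) * -π) = 0 := by rw [mul_neg, sin_neg, sin_int_mul_pi, neg_zero]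
    rw [sin_int_mul_pi, e, mul_zero, mul_zero, sub_zero] at this
    simp only [heatKernel]
    linear_combination (2 * π)⁻¹ * this
  all_goals exact Continuous.intervalIntegrable (by fun_prop) _ _

lemma sq_mul_heatKernel (t : ℝ) (m : ℤ) :
    (m : ℝ) ^ 2 * heatKernel t m =
      t ^ 2 * (heatKernel t (m - 2) - 2 * heatKernel t m + heatKernel t (m + 2)) +
        t * (heatKernel t (m - 1) + heatKernel t (m + 1)) := by
  have h0 := intCast_mul_heatKernel t m
  have h1 := intCast_mul_heatKernel t (m - 1)
  have h2 := intCast_mul_heatKernel t (m + 1)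
  rw [show m - 1 - 1 = m - 2 by ring, show m - 1 + 1 = m by ring] at h1
  rw [show m + 1 - 1 = m by ring, show m + 1 + 1 = m + 2 by ring] at h2
  push_cast at h1 h2
  linear_combination m * h0 + t * (h1 - h2)

lemma pow_four_mul_heatKernel (t : ℝ) (m : ℤ) :
    (m : ℝ) ^ 4 * heatKernel t m =
      t ^ 4 * (heatKernel t (m - 4) - 4 * heatKernel t (m - 2) + 6 * heatKernel t m
          - 4 * heatKernel t (m + 2) + heatKernel t (m + 4)) +
        6 * t ^ 3 * (heatKernel t (m - 3) - heatKernel t (m - 1)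
          - heatKernel t (m + 1) + heatKernel t (m + 3)) +
        3 * t ^ 2 * (heatKernel t (m - 2) + 2 * heatKernel t m + heatKernel t (m + 2)) +
        4 * t ^ 2 * (heatKernel t (m - 2) - 2 * heatKernel t m + heatKernel t (m + 2)) +
        t * (heatKernel t (m - 1) + heatKernel t (m + 1)) := by
  have a0 := sq_mul_heatKernel t m
  have a1 := sq_mul_heatKernel t (m - 1)
  have a2 := sq_mul_heatKernel t (m + 1)
  have a3 := sq_mul_heatKernel t (m - 2)
  have a4 := sq_mul_heatKernel t (m + 2)
  have b1 := intCast_mul_heatKernel t (m - 1)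
  have b2 := intCast_mul_heatKernel t (m + 1)
  have b3 := intCast_mul_heatKernel t (m - 2)
  have b4 := intCast_mul_heatKernel t (m + 2)
  ring_nf at a1 a2 a3 a4 b1 b2 b3 b4
  ring_nf
  ring_nf at a0
  push_cast at *
  -- Multiply the second-moment identity by m² and expand m² = j² + 2(m − j)j + (m − j)² at each
  -- shifted index j.
  linear_combination (m ^ 2 - 2 * t ^ 2) * a0 + t * (a1 + 2 * b1) + t * (a2 - 2 * b2)
    + t ^ 2 * (a3 + 4 * b3) + t ^ 2 * (a4 - 4 * b4)

end LatticeKernel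

/-! ### Decay of the lattice kernel, locally uniformly in time and on the diffusive scale. -/

noncomputable section LatticeKernelBounds

open Real MeasureTheory

lemma abs_heatKernel_le {T t : ℝ} (ht : |t| ≤ T) (m : ℤ) : |heatKernel t m| ≤ exp (4 * T) := by
  have hpi := pi_pos
  have h : ‖∫ θ in (-π)..π, exp (-2 * t * (1 - cos θ)) * cos (m * θ)‖
      ≤ exp (4 * T) * |π - -π| := by
    apply intervalIntegral.norm_integral_le_of_norm_le_const
    intro θ _
    rw [norm_mul, Real.norm_eq_abs, Real.norm_eq_abs, abs_exp]
    exact (mul_le_mul (exp_neg_mul_one_sub_cos_le ht θ) (abs_cos_le_one _) (abs_nonneg _)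
      (exp_pos _).le).trans (mul_one _).le
  rw [heatKernel, abs_mul, abs_of_pos (by positivity : 0 < (2 * π)⁻¹),
    ← Real.norm_eq_abs (∫ _ in _.._, _)]
  rw [sub_neg_eq_add, ← two_mul, abs_of_pos (by positivity : 0 < 2 * π)] at h
  calc _ ≤ (2 * π)⁻¹ * (exp (4 * T) * (2 * π)) := by gcongr
    _ = _ := by field_simp

/-- Two integrations by parts express m² times the kernel through bounded kernel values. Uniformity
over bounded times of either sign is what termwise differentiation of the semigroup needs. -/
lemma exists_heatKernel_decay (T : ℝ) (hT : 0 ≤ T) :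
    ∃ C, 0 ≤ C ∧ ∀ t, |t| ≤ T → ∀ m : ℤ, |heatKernel t m| ≤ C * (1 + (m : ℝ) ^ 2)⁻¹ := by
  refine ⟨exp (4 * T) * (1 + 4 * T ^ 2 + 2 * T), by positivity, fun t ht m => ?_⟩
  have hb := fun n => abs_heatKernel_le ht n
  rw [← div_eq_mul_inv, le_div_iff₀ (by positivity)]
  have h := sq_mul_heatKernel t m
  have e : |heatKernel t m| * (m : ℝ) ^ 2 = |(m : ℝ) ^ 2 * heatKernel t m| := by
    rw [abs_mul, abs_of_nonneg (by positivity : (0 : ℝ) ≤ (m : ℝ) ^ 2), mul_comm]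
  rw [mul_add, mul_one, e, h]
  set M := exp (4 * T)
  have h1 : |heatKernel t (m - 2) - 2 * heatKernel t m + heatKernel t (m + 2)| ≤ 4 * M := by
    have a := abs_le.1 (hb (m - 2)); have b := abs_le.1 (hb m); have c := abs_le.1 (hb (m + 2))
    rw [abs_le]; constructor <;> linarith
  have h2 : |heatKernel t (m - 1) + heatKernel t (m + 1)| ≤ 2 * M := by
    have a := abs_le.1 (hb (m - 1)); have c := abs_le.1 (hb (m + 1))
    rw [abs_le]; constructor <;> linarith
  calc _ ≤ M + (|t| ^ 2 * (4 * M) + |t| * (2 * M)) := by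
        refine add_le_add (hb m) ((abs_add_le _ _).trans ?_)
        rw [abs_mul, abs_mul, abs_pow]
        gcongr
    _ ≤ M + (T ^ 2 * (4 * M) + T * (2 * M)) := by
        have : 0 ≤ M := (exp_pos _).le
        gcongr
    _ = _ := by ring

lemma exp_neg_mul_one_sub_cos_le_gaussian {t θ : ℝ} (ht : 0 ≤ t) (hθ : |θ| ≤ π) :
    exp (-2 * t * (1 - cos θ)) ≤ exp (-(4 / π ^ 2 * t) * θ ^ 2) := by
  apply exp_le_exp.2
  have h := cos_le_one_sub_mul_cos_sq hθ
  have h2 : 4 / π ^ 2 * t * θ ^ 2 = 2 * t * (2 / π ^ 2 * θ ^ 2) := by ring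
  nlinarith

/-- Half of the exponent absorbs the power, through (ax)^j ≤ j!·exp(ax). -/
lemma mul_pow_mul_exp_neg_le (j : ℕ) {a x : ℝ} (ha : 0 < a) (hx : 0 ≤ x) :
    x ^ j * exp (-(2 * a) * x) ≤ j.factorial * (1 / a) ^ j * exp (-a * x) := by
  have h := pow_div_factorial_le_exp (a * x) (by positivity) j
  rw [div_le_iff₀ (by positivity), mul_pow] at h
  have e : exp (-(2 * a) * x) = exp (-a * x) * exp (-(a * x)) := by
    rw [← exp_add]; ring_nf
  have e2 : exp (a * x) * exp (-(a * x)) = 1 := by rw [← exp_add]; simp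
  calc x ^ j * exp (-(2 * a) * x)
      = (1 / a) ^ j * (a ^ j * x ^ j) * exp (-(a * x)) * exp (-a * x) := by
        rw [e, one_div, inv_pow]; field_simp
    _ ≤ (1 / a) ^ j * (exp (a * x) * j.factorial) * exp (-(a * x)) * exp (-a * x) := by gcongr
    _ = (exp (a * x) * exp (-(a * x))) * (j.factorial * (1 / a) ^ j * exp (-a * x)) := by ring
    _ = _ := by rw [e2, one_mul]

/-- Fourier integrals against a weight of size `θ ^ (2 j)` decay like `t ^ (-j - 1 / 2)`. -/
lemma exists_fourier_weight_bound (j : ℕ) (c : ℝ) (hc : 0 ≤ c) :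
    ∃ C, 0 ≤ C ∧ ∀ t, 0 < t → ∀ W : ℝ → ℝ, Continuous W → (∀ θ, |W θ| ≤ c * θ ^ (2 * j)) →
      √t * t ^ j * |(2 * π)⁻¹ * ∫ θ in (-π)..π, exp (-2 * t * (1 - cos θ)) * W θ| ≤ C := by
  have hpi := pi_pos
  set A : ℝ := c * (j.factorial * (1 / (2 / π ^ 2)) ^ j) with hA
  have hA0 : 0 ≤ A := by positivity
  refine ⟨(2 * π)⁻¹ * (A * √(π / (2 / π ^ 2))), by positivity, fun t ht W hW hWb => ?_⟩
  have h2 : (0 : ℝ) < 2 / π ^ 2 * t := by positivity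
  have hpt : ∀ θ ∈ Icc (-π) π, ‖t ^ j * (exp (-2 * t * (1 - cos θ)) * W θ)‖
      ≤ A * exp (-(2 / π ^ 2 * t) * θ ^ 2) := by
    intro θ hθ
    have h1 := exp_neg_mul_one_sub_cos_le_gaussian ht.le (abs_le.2 hθ)
    have h3 := mul_pow_mul_exp_neg_le j (a := 2 / π ^ 2) (x := t * θ ^ 2) (by positivity)
      (by positivity)
    rw [norm_mul, norm_mul, Real.norm_eq_abs, Real.norm_eq_abs, Real.norm_eq_abs, abs_exp,
      abs_of_pos (by positivity : 0 < t ^ j)]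
    calc t ^ j * (exp (-2 * t * (1 - cos θ)) * |W θ|)
        ≤ t ^ j * (exp (-(4 / π ^ 2 * t) * θ ^ 2) * (c * θ ^ (2 * j))) := by
          gcongr
          exact hWb θ
      _ = c * ((t * θ ^ 2) ^ j * exp (-(2 * (2 / π ^ 2)) * (t * θ ^ 2))) := by
          rw [mul_pow, ← pow_mul]; ring_nf
      _ ≤ c * (j.factorial * (1 / (2 / π ^ 2)) ^ j * exp (-(2 / π ^ 2) * (t * θ ^ 2))) := by
          gcongr
      _ = _ := by rw [hA]; ring_nf
  have hint : ‖∫ θ in (-π)..π, t ^ j * (exp (-2 * t * (1 - cos θ)) * W θ)‖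
      ≤ A * √(π / (2 / π ^ 2 * t)) := by
    have hg : Integrable (fun θ : ℝ => A * exp (-(2 / π ^ 2 * t) * θ ^ 2)) :=
      (integrable_exp_neg_mul_sq h2).const_mul A
    refine (intervalIntegral.norm_integral_le_of_norm_le (by linarith)
      (ae_of_all _ fun θ hθ => hpt θ (Ioc_subset_Icc_self hθ)) hg.intervalIntegrable).trans ?_
    rw [intervalIntegral.integral_of_le (by linarith), ← integral_gaussian,
      ← integral_const_mul]
    exact setIntegral_le_integral hg (ae_of_all _ fun θ => by positivity)
  have hs : √t * √(π / (2 / π ^ 2 * t)) = √(π / (2 / π ^ 2)) := by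
    rw [← sqrt_mul ht.le]; congr 1; field_simp
  rw [intervalIntegral.integral_const_mul, Real.norm_eq_abs, abs_mul,
    abs_of_pos (by positivity : 0 < t ^ j)] at hint
  rw [abs_mul, abs_of_pos (by positivity : 0 < (2 * π)⁻¹)]
  calc _ = (2 * π)⁻¹ * (√t * (t ^ j * |∫ θ in (-π)..π, exp (-2 * t * (1 - cos θ)) * W θ|)) := by
        ring
    _ ≤ (2 * π)⁻¹ * (√t * (A * √(π / (2 / π ^ 2 * t)))) := by gcongr
    _ = _ := by rw [← hs]; ring

/-- Shifts by ±2 produce the factor 2cos 2θ − 2 = −4sin²θ. Its double zero at θ = 0 makes each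
second difference gain a factor 1/t. -/
lemma heatKernel_second_difference (t : ℝ) (m : ℤ) :
    heatKernel t (m - 2) - 2 * heatKernel t m + heatKernel t (m + 2) =
      (2 * π)⁻¹ * ∫ θ in (-π)..π, exp (-2 * t * (1 - cos θ)) *
        (-4 * sin θ ^ 2 * cos (m * θ)) := by
  simp only [heatKernel]
  rw [mul_left_comm, ← mul_sub, ← mul_add, ← intervalIntegral.integral_const_mul,
    ← intervalIntegral.integral_sub, ← intervalIntegral.integral_add]
  · congr 1
    apply intervalIntegral.integral_congr
    intro θ _
    simp only
    push_cast
    rw [add_mul, sub_mul, cos_add, cos_sub, cos_two_mul, sin_two_mul, cos_sq']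
    ring
  all_goals exact Continuous.intervalIntegrable (by fun_prop) _ _

lemma heatKernel_fourth_difference (t : ℝ) (m : ℤ) :
    heatKernel t (m - 4) - 4 * heatKernel t (m - 2) + 6 * heatKernel t m
        - 4 * heatKernel t (m + 2) + heatKernel t (m + 4) =
      (2 * π)⁻¹ * ∫ θ in (-π)..π, exp (-2 * t * (1 - cos θ)) *
        (16 * sin θ ^ 4 * cos (m * θ)) := by
  have h0 := heatKernel_second_difference t m
  have h1 := heatKernel_second_difference t (m - 2)
  have h2 := heatKernel_second_difference t (m + 2)
  have e : heatKernel t (m - 4) - 4 * heatKernel t (m - 2) + 6 * heatKernel t m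
        - 4 * heatKernel t (m + 2) + heatKernel t (m + 4) =
      (heatKernel t (m - 2 - 2) - 2 * heatKernel t (m - 2) + heatKernel t (m - 2 + 2))
      - 2 * (heatKernel t (m - 2) - 2 * heatKernel t m + heatKernel t (m + 2))
      + (heatKernel t (m + 2 - 2) - 2 * heatKernel t (m + 2) + heatKernel t (m + 2 + 2)) := by
    ring_nf
  rw [e, h0, h1, h2, mul_left_comm, ← mul_sub, ← mul_add, ← intervalIntegral.integral_const_mul,
    ← intervalIntegral.integral_sub, ← intervalIntegral.integral_add]
  · congr 1
    apply intervalIntegral.integral_congr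
    intro θ _
    simp only
    push_cast
    have h4 : sin θ ^ 4 = sin θ ^ 2 * (1 - cos θ ^ 2) := by rw [← sin_sq]; ring
    rw [add_mul, sub_mul, cos_add, cos_sub, cos_two_mul, sin_two_mul, h4]
    ring
  all_goals exact Continuous.intervalIntegrable (by fun_prop) _ _

/-- On scale `√t`, the heat kernel decays at least like the inverse fourth power. -/
lemma exists_heatKernel_scaled_decay :
    ∃ C, 0 ≤ C ∧ ∀ t, 1 ≤ t → ∀ m : ℤ,
      √t * |heatKernel t m| ≤ C * ((1 + (m : ℝ) ^ 2 / t) ^ 2)⁻¹ := by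
  obtain ⟨C0, hC0, h0⟩ := exists_fourier_weight_bound 0 1 (by norm_num)
  obtain ⟨C2, hC2, h2⟩ := exists_fourier_weight_bound 1 4 (by norm_num)
  obtain ⟨C4, hC4, h4⟩ := exists_fourier_weight_bound 2 16 (by norm_num)
  refine ⟨2 * (C0 + (C4 + 12 * C2 + 14 * C0 + 4 * C2)), by positivity, fun t ht m => ?_⟩
  have ht0 : 0 < t := by linarith
  have hs : 0 ≤ √t := sqrt_nonneg t
  have k0 : ∀ n, √t * |heatKernel t n| ≤ C0 := fun n => by
    have := h0 t ht0 (fun θ => cos (n * θ)) (by fun_prop)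
      (fun θ => by simpa using abs_cos_le_one _)
    simpa [heatKernel] using this
  have hsin : ∀ θ, |sin θ| ≤ |θ| := fun θ => abs_sin_le_abs
  have k2 : ∀ n, √t * (t * |heatKernel t (n - 2) - 2 * heatKernel t n + heatKernel t (n + 2)|)
      ≤ C2 := fun n => by
    have := h2 t ht0 (fun θ => -4 * sin θ ^ 2 * cos (n * θ)) (by fun_prop) (fun θ => by
      have e : |-4 * sin θ ^ 2 * cos (n * θ)| = 4 * |sin θ| ^ 2 * |cos (n * θ)| := by
        rw [abs_mul, abs_mul, abs_pow]; norm_num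
      rw [e, mul_one, ← sq_abs θ]
      exact (mul_le_mul (mul_le_mul_of_nonneg_left (pow_le_pow_left₀ (abs_nonneg _) (hsin θ) _)
        (by norm_num)) (abs_cos_le_one _) (abs_nonneg _) (by positivity)).trans (mul_one _).le)
    rwa [← heatKernel_second_difference, pow_one, mul_assoc] at this
  have k4 : √t * (t ^ 2 * |heatKernel t (m - 4) - 4 * heatKernel t (m - 2) + 6 * heatKernel t m
        - 4 * heatKernel t (m + 2) + heatKernel t (m + 4)|) ≤ C4 := by
    have := h4 t ht0 (fun θ => 16 * sin θ ^ 4 * cos (m * θ)) (by fun_prop) (fun θ => by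
      have e : |16 * sin θ ^ 4 * cos (m * θ)| = 16 * |sin θ| ^ 4 * |cos (m * θ)| := by
        rw [abs_mul, abs_mul, abs_pow]; norm_num
      rw [e, show θ ^ (2 * 2) = |θ| ^ 4 by rw [Even.pow_abs (by decide)]]
      exact (mul_le_mul (mul_le_mul_of_nonneg_left (pow_le_pow_left₀ (abs_nonneg _) (hsin θ) _)
        (by norm_num)) (abs_cos_le_one _) (abs_nonneg _) (by positivity)).trans (mul_one _).le)
    rwa [← heatKernel_fourth_difference, mul_assoc] at this
  set D4 := heatKernel t (m - 4) - 4 * heatKernel t (m - 2) + 6 * heatKernel t m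
        - 4 * heatKernel t (m + 2) + heatKernel t (m + 4)
  have a1 := k2 (m - 1)
  have a2 := k2 (m + 1)
  rw [show m - 1 - 2 = m - 3 by ring, show m - 1 + 2 = m + 1 by ring] at a1
  rw [show m + 1 - 2 = m - 1 by ring, show m + 1 + 2 = m + 3 by ring] at a2
  have a0 := k2 m
  set E1 := heatKernel t (m - 3) - 2 * heatKernel t (m - 1) + heatKernel t (m + 1)
  set E2 := heatKernel t (m - 1) - 2 * heatKernel t (m + 1) + heatKernel t (m + 3)
  set E0 := heatKernel t (m - 2) - 2 * heatKernel t m + heatKernel t (m + 2)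
  -- In the fourth-moment identity the fourth difference carries t⁴ and gains t⁻²; the t³ term is a
  -- sum of two second differences, each gaining t⁻¹. Everything is thus O(t²) after multiplication
  -- by √t, lower powers being absorbed by t ≥ 1.
  have key : √t * ((m : ℝ) ^ 4 * |heatKernel t m|)
      ≤ t ^ 2 * (C4 + 12 * C2 + 14 * C0 + 4 * C2) := by
    have e : (m : ℝ) ^ 4 * |heatKernel t m| = |(m : ℝ) ^ 4 * heatKernel t m| := by
      rw [abs_mul, abs_of_nonneg (by positivity : (0 : ℝ) ≤ (m : ℝ) ^ 4)]
    have e2 : (m : ℝ) ^ 4 * heatKernel t m = t ^ 2 * (t ^ 2 * D4) + t ^ 2 * (6 * (t * E1))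
        + t ^ 2 * (6 * (t * E2)) + t ^ 2 * (3 * heatKernel t (m - 2)) +
        t ^ 2 * (6 * heatKernel t m) +
        t ^ 2 * (3 * heatKernel t (m + 2)) + t * (4 * (t * E0)) +
        t * heatKernel t (m - 1) + t * heatKernel t (m + 1) := by
      rw [pow_four_mul_heatKernel]; ring
    have tri : |(m : ℝ) ^ 4 * heatKernel t m| ≤ t ^ 2 * (t ^ 2 * |D4|) + t ^ 2 * (6 * (t * |E1|))
        + t ^ 2 * (6 * (t * |E2|)) + t ^ 2 * (3 * |heatKernel t (m - 2)|) +
        t ^ 2 * (6 * |heatKernel t m|) +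
        t ^ 2 * (3 * |heatKernel t (m + 2)|) + t * (4 * (t * |E0|)) +
        t * |heatKernel t (m - 1)| + t * |heatKernel t (m + 1)| := by
      rw [e2]
      iterate 8 refine (abs_add_le _ _).trans (add_le_add ?_ ?_)
      all_goals simp only [abs_mul, abs_pow, abs_of_pos ht0, le_refl, Nat.abs_ofNat]
    rw [e]
    have tt : t ≤ t ^ 2 := by nlinarith
    have b1 := k0 (m - 2); have b2 := k0 m; have b3 := k0 (m + 2)
    have b4 := k0 (m - 1); have b5 := k0 (m + 1)
    calc √t * |(m : ℝ) ^ 4 * heatKernel t m|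
        ≤ √t * (t ^ 2 * (t ^ 2 * |D4|) + t ^ 2 * (6 * (t * |E1|))
        + t ^ 2 * (6 * (t * |E2|)) + t ^ 2 * (3 * |heatKernel t (m - 2)|) +
        t ^ 2 * (6 * |heatKernel t m|) +
        t ^ 2 * (3 * |heatKernel t (m + 2)|) + t ^ 2 * (4 * (t * |E0|)) +
        t ^ 2 * |heatKernel t (m - 1)| + t ^ 2 * |heatKernel t (m + 1)|) := by
          refine mul_le_mul_of_nonneg_left (tri.trans ?_) hs
          gcongr
      _ = t ^ 2 * (√t * (t ^ 2 * |D4|) + 6 * (√t * (t * |E1|)) + 6 * (√t * (t * |E2|)) +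
          3 * (√t * |heatKernel t (m - 2)|) + 6 * (√t * |heatKernel t m|) +
          3 * (√t * |heatKernel t (m + 2)|) + 4 * (√t * (t * |E0|)) +
          √t * |heatKernel t (m - 1)| + √t * |heatKernel t (m + 1)|) := by ring
      _ ≤ _ := mul_le_mul_of_nonneg_left (by linarith) (by positivity)
  rw [← div_eq_mul_inv, le_div_iff₀ (by positivity)]
  have h5 : (1 + (m : ℝ) ^ 2 / t) ^ 2 ≤ 2 * (1 + (m : ℝ) ^ 4 / t ^ 2) := by
    have : (m : ℝ) ^ 4 / t ^ 2 = ((m : ℝ) ^ 2 / t) ^ 2 := by rw [div_pow]; ring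
    rw [this]
    nlinarith [sq_nonneg (1 - (m : ℝ) ^ 2 / t)]
  calc _ ≤ √t * |heatKernel t m| * (2 * (1 + (m : ℝ) ^ 4 / t ^ 2)) := by gcongr
    _ = 2 * (√t * |heatKernel t m| + √t * ((m : ℝ) ^ 4 * |heatKernel t m|) / t ^ 2) := by ring
    _ ≤ _ := by
        gcongr
        · exact k0 m
        · rw [div_le_iff₀ (by positivity)]
          linarith [key]

end LatticeKernelBounds

/-! ### The local central limit theorem. -/

noncomputable section LocalLimit

open Real MeasureTheory

/-- Half-angle formula; `sinc` removes the singularity at u = 0 and makes the Gaussian limit −u²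
visible. -/
lemma mul_one_sub_cos_div_sqrt {t : ℝ} (ht : 0 < t) (u : ℝ) :
    -2 * t * (1 - cos (u / √t)) = -u ^ 2 * sinc (u / (2 * √t)) ^ 2 := by
  set v := u / (2 * √t) with hv
  have hs : 0 < √t := sqrt_pos.2 ht
  have h1 : u / √t = 2 * v := by rw [hv]; field_simp
  have h2 : u = 2 * √t * v := by rw [hv]; field_simp
  have h3 : v * sinc v = sin v := by
    by_cases h : v = 0
    · simp [h]
    · rw [sinc_of_ne_zero h]; field_simp
  have h4 : √t ^ 2 = t := sq_sqrt ht.le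
  have h5 := sin_sq_add_cos_sq v
  rw [h1, cos_two_mul, h2]
  calc _ = -4 * t * (1 - cos v ^ 2) := by ring
    _ = -4 * t * (v * sinc v) ^ 2 := by rw [h3]; linear_combination 4 * t * h5
    _ = _ := by linear_combination (4 * v ^ 2 * sinc v ^ 2) * h4

lemma integral_exp_neg_sq_mul_cos (x : ℝ) :
    ∫ u : ℝ, exp (-u ^ 2) * cos (x * u) = √π * exp (-x ^ 2 / 4) := by
  have h := fourierIntegral_gaussian (b := 1) (by simp) (x : ℂ)
  have e : ∀ u : ℝ, Complex.exp (Complex.I * x * u) * Complex.exp (-1 * (u : ℂ) ^ 2)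
      = (exp (-u ^ 2) : ℝ) * Complex.exp ((x * u : ℝ) * Complex.I) := by
    intro u
    push_cast
    rw [mul_comm]
    ring_nf
  have hi : Integrable (fun u : ℝ => ((exp (-u ^ 2) : ℝ) : ℂ) *
      Complex.exp ((x * u : ℝ) * Complex.I)) := by
    refine ((integrable_exp_neg_mul_sq (b := 1) one_pos).mono' (Continuous.aestronglyMeasurable
      (by fun_prop)) (ae_of_all _ fun u => ?_))
    rw [norm_mul, Complex.norm_exp_ofReal_mul_I, Complex.norm_real, norm_of_nonneg (exp_pos _).le]
    simp
  simp_rw [e] at h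
  have h2 := Complex.reCLM.integral_comp_comm hi
  rw [h] at h2
  have e2 : ∀ u : ℝ, Complex.reCLM (((exp (-u ^ 2) : ℝ) : ℂ) *
      Complex.exp ((x * u : ℝ) * Complex.I)) = exp (-u ^ 2) * cos (x * u) := by
    intro u
    rw [Complex.reCLM_apply, Complex.re_ofReal_mul, Complex.exp_ofReal_mul_I_re]
  simp_rw [e2] at h2
  rw [h2]
  have e3 : ((π : ℂ) / 1) ^ (1 / 2 : ℂ) * Complex.exp (-(x : ℂ) ^ 2 / (4 * 1))
      = ((√π * exp (-x ^ 2 / 4) : ℝ) : ℂ) := by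
    rw [sqrt_eq_rpow]
    push_cast
    rw [Complex.ofReal_cpow pi_pos.le]
    simp
  rw [e3, Complex.reCLM_apply, Complex.ofReal_re]

/-- Local central limit theorem for the heat kernel on `ℤ`. -/
lemma tendsto_sqrt_mul_heatKernel {ι : Type*} {l : Filter ι} [l.IsCountablyGenerated]
    {t : ι → ℝ} {m : ι → ℤ} {x : ℝ} (ht : Tendsto t l atTop)
    (hm : Tendsto (fun i => (m i : ℝ) / √(t i)) l (𝓝 x)) :
    Tendsto (fun i => √(t i) * heatKernel (t i) (m i)) l
      (𝓝 ((2 * √π)⁻¹ * exp (-x ^ 2 / 4))) := by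
  have hpi := pi_pos
  have hlim : (2 * √π)⁻¹ * exp (-x ^ 2 / 4) = (2 * π)⁻¹ * ∫ u : ℝ, exp (-u ^ 2) * cos (x * u) := by
    rw [integral_exp_neg_sq_mul_cos]
    have : √π * √π = π := mul_self_sqrt hpi.le
    have h0 : √π ≠ 0 := by positivity
    field_simp
    linear_combination (-1 : ℝ) * this
  have hsq : Tendsto (fun i => √(t i)) l atTop := tendsto_sqrt_atTop.comp ht
  -- The substitution θ = u/√t; the indicator moves the growing interval of integration into the
  -- integrand, so that dominated convergence applies on the whole line.
  set F : ι → ℝ → ℝ := fun i => indicator (Ioc (-(π * √(t i))) (π * √(t i)))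
    (fun u => exp (-2 * t i * (1 - cos (u / √(t i)))) * cos (m i * (u / √(t i)))) with hF
  have heq : (fun i => (2 * π)⁻¹ * ∫ u, F i u) =ᶠ[l]
      fun i => √(t i) * heatKernel (t i) (m i) := by
    filter_upwards [ht.eventually_gt_atTop 0] with i hi
    have hs : 0 < √(t i) := sqrt_pos.2 hi
    rw [heatKernel, hF, integral_indicator measurableSet_Ioc,
      ← intervalIntegral.integral_of_le (by nlinarith [mul_pos hpi hs]),
      intervalIntegral.integral_comp_div
        (fun θ => exp (-2 * t i * (1 - cos θ)) * cos (m i * θ)) hs.ne', neg_div,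
      mul_div_cancel_right₀ _ hs.ne', smul_eq_mul]
    ring
  rw [hlim]
  refine Tendsto.congr' heq (Tendsto.const_mul _ ?_)
  refine tendsto_integral_filter_of_dominated_convergence
    (fun u => exp (-(4 / π ^ 2) * u ^ 2)) ?_ ?_ (integrable_exp_neg_mul_sq (by positivity)) ?_
  · exact Eventually.of_forall fun i => Measurable.aestronglyMeasurable
      (Measurable.indicator (Continuous.measurable (by fun_prop)) measurableSet_Ioc)
  · filter_upwards [ht.eventually_gt_atTop 0] with i hi
    have hs : 0 < √(t i) := sqrt_pos.2 hi
    refine ae_of_all _ fun u => ?_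
    by_cases hu : u ∈ Ioc (-(π * √(t i))) (π * √(t i))
    · rw [hF]
      simp only [indicator_of_mem hu]
      have h1 : |u / √(t i)| ≤ π := by
        rw [abs_div, abs_of_pos hs, div_le_iff₀ hs, abs_le]
        exact ⟨hu.1.le, hu.2⟩
      have h2 := exp_neg_mul_one_sub_cos_le_gaussian hi.le h1
      have h3 : -(4 / π ^ 2 * t i) * (u / √(t i)) ^ 2 = -(4 / π ^ 2) * u ^ 2 := by
        rw [div_pow, sq_sqrt hi.le]; field_simp
      rw [h3] at h2
      rw [norm_mul, Real.norm_eq_abs, Real.norm_eq_abs, abs_exp]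
      exact (mul_le_mul h2 (abs_cos_le_one _) (abs_nonneg _) (exp_pos _).le).trans (mul_one _).le
    · rw [hF]
      simp only [indicator_of_notMem hu, norm_zero]
      positivity
  · refine ae_of_all _ fun u => ?_
    have hmem : ∀ᶠ i in l, F i u = exp (-u ^ 2 * sinc (u / (2 * √(t i))) ^ 2)
        * cos (m i / √(t i) * u) := by
      filter_upwards [ht.eventually_gt_atTop 0, hsq.eventually_gt_atTop (|u| / π)] with i hi h2
      rw [div_lt_iff₀ hpi, mul_comm] at h2
      have h3 := abs_lt.1 h2
      rw [hF]
      simp only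
      rw [indicator_of_mem (show u ∈ Ioc (-(π * √(t i))) (π * √(t i)) from ⟨h3.1, h3.2.le⟩),
        mul_one_sub_cos_div_sqrt hi]
      congr 2
      ring
    refine Tendsto.congr' (hmem.mono fun i hi => hi.symm) ?_
    have h1 : Tendsto (fun i => u / (2 * √(t i))) l (𝓝 0) :=
      (hsq.const_mul_atTop two_pos).const_div_atTop u
    have h2 : Tendsto (fun i => sinc (u / (2 * √(t i)))) l (𝓝 1) := by
      have := (continuous_sinc.tendsto 0).comp h1
      rwa [sinc_zero] at this
    have h3 : Tendsto (fun i => exp (-u ^ 2 * sinc (u / (2 * √(t i))) ^ 2)) l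
        (𝓝 (exp (-u ^ 2))) := by
      have := ((h2.pow 2).const_mul (-u ^ 2)).rexp
      simpa using this
    exact h3.mul ((continuous_cos.tendsto _).comp (hm.mul_const u))

end LocalLimit

/-! ### Lattice sums as integrals, and uniform kernel moments. -/

noncomputable section FloorIntegral

open MeasureTheory

/-- Each fibre of the floor map is a unit interval. Sums over `ℤ` thereby become integrals over ℝ,
where rescaling and dominated convergence are available. -/
lemma map_floor_volume : (volume : Measure ℝ).map Int.floor = Measure.count := by
  refine Measure.ext_of_singleton fun n => ?_
  rw [Measure.map_apply Int.measurable_floor (measurableSet_singleton n), Measure.count_singleton,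
    Int.preimage_floor_singleton, Real.volume_Ico]
  simp

lemma integrable_comp_floor_iff {F : ℤ → ℝ} :
    Integrable (fun y : ℝ => F ⌊y⌋) ↔ Summable F := by
  have h := integrable_map_measure (μ := (volume : Measure ℝ)) (f := Int.floor) (g := F)
    (by fun_prop) Int.measurable_floor.aemeasurable
  rw [map_floor_volume, integrable_count_iff] at h
  rw [← summable_norm_iff, h]
  rfl

lemma integral_comp_floor {F : ℤ → ℝ} (hF : Summable F) : ∫ y : ℝ, F ⌊y⌋ = ∑' n, F n := by
  have h := integral_map (μ := (volume : Measure ℝ)) (φ := Int.floor) (f := F)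
    Int.measurable_floor.aemeasurable (by fun_prop)
  rw [map_floor_volume] at h
  rw [← h, integral_countable (integrable_count_iff.2 hF.norm)]
  simp [Measure.real]

lemma integral_comp_floor_mul {F : ℤ → ℝ} (hF : Summable F) {c : ℝ} (hc : 0 < c) :
    ∑' n, F n = c * ∫ y : ℝ, F ⌊y * c⌋ := by
  rw [Measure.integral_comp_mul_right (fun y => F ⌊y⌋), integral_comp_floor hF, abs_inv,
    abs_of_pos hc, smul_eq_mul, mul_inv_cancel_left₀ hc.ne']

lemma inv_one_add_sq_floor_le {c y : ℝ} (hc : 1 ≤ c) :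
    (1 + (⌊y * c⌋ / c : ℝ) ^ 2)⁻¹ ≤ 3 * (1 + y ^ 2)⁻¹ := by
  have hc0 : 0 < c := by linarith
  set x : ℝ := ⌊y * c⌋ / c with hx
  have h1 : x ≤ y := by rw [hx, div_le_iff₀ hc0]; exact Int.floor_le _
  have h2 : y ≤ x + 1 := by
    rw [hx, div_add_one hc0.ne', le_div_iff₀ hc0]
    exact (Int.lt_floor_add_one _).le.trans (by linarith)
  rw [← div_eq_mul_inv, inv_eq_one_div, div_le_div_iff₀ (by positivity) (by positivity)]
  nlinarith [sq_nonneg (2 * x - y), sq_nonneg (y - x), sq_nonneg (x - 1), sq_nonneg (x + 1),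
    mul_nonneg (sub_nonneg.2 h1) (by linarith : 0 ≤ x + 1 - y)]

lemma summable_inv_one_add_sq : Summable fun m : ℤ => (1 + (m : ℝ) ^ 2)⁻¹ := by
  rw [← integrable_comp_floor_iff (F := fun m : ℤ => (1 + (m : ℝ) ^ 2)⁻¹)]
  refine (integrable_inv_one_add_sq.const_mul 3).mono' ?_ (ae_of_all _ fun y => ?_)
  · exact Measurable.aestronglyMeasurable (by fun_prop)
  · rw [Real.norm_of_nonneg (by positivity)]
    simpa using inv_one_add_sq_floor_le (c := 1) (y := y) le_rfl

lemma summable_inv_one_add_sq_div {t : ℝ} (ht : 1 ≤ t) :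
    Summable fun m : ℤ => (1 + (m : ℝ) ^ 2 / t)⁻¹ := by
  have ht0 : 0 < t := by linarith
  refine (summable_inv_one_add_sq.mul_left t).of_nonneg_of_le (fun m => by positivity) fun m => ?_
  rw [← div_eq_mul_inv, inv_eq_one_div, div_le_div_iff₀ (by positivity) (by positivity)]
  have : t * ((m : ℝ) ^ 2 / t) = (m : ℝ) ^ 2 := by field_simp
  nlinarith

lemma tsum_inv_one_add_sq_div_le {t : ℝ} (ht : 1 ≤ t) :
    ∑' m : ℤ, (1 + (m : ℝ) ^ 2 / t)⁻¹ ≤ √t * (3 * ∫ y : ℝ, (1 + y ^ 2)⁻¹) := by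
  have ht0 : 0 < t := by linarith
  have hs : 1 ≤ √t := Real.one_le_sqrt.2 ht
  rw [integral_comp_floor_mul (summable_inv_one_add_sq_div ht) (Real.sqrt_pos.2 ht0)]
  refine mul_le_mul_of_nonneg_left ?_ (Real.sqrt_nonneg t)
  rw [← integral_const_mul]
  refine integral_mono_of_nonneg (ae_of_all _ fun y => by positivity)
    (integrable_inv_one_add_sq.const_mul 3) (ae_of_all _ fun y => ?_)
  have := inv_one_add_sq_floor_le (y := y) hs
  rwa [div_pow, Real.sq_sqrt ht0.le] at this

/-- Of the two factors 1 + m²/t in the scaled decay, one pays for the moment and the other sums to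
O(√t), which cancels the prefactor 1/√t. -/
lemma exists_heatKernel_moment_bound :
    ∃ C, 0 ≤ C ∧ ∀ t, 1 ≤ t →
      (Summable fun m : ℤ => (1 + (m : ℝ) ^ 2 / t) * |heatKernel t m|) ∧
      ∑' m : ℤ, (1 + (m : ℝ) ^ 2 / t) * |heatKernel t m| ≤ C := by
  obtain ⟨C, hC, h⟩ := exists_heatKernel_scaled_decay
  have hI : 0 ≤ ∫ y : ℝ, (1 + y ^ 2)⁻¹ := integral_nonneg fun y => by positivity
  refine ⟨C * (3 * ∫ y : ℝ, (1 + y ^ 2)⁻¹), by positivity, fun t ht => ?_⟩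
  have ht0 : 0 < t := by linarith
  have hs : 0 < √t := Real.sqrt_pos.2 ht0
  have hb : ∀ m : ℤ, (1 + (m : ℝ) ^ 2 / t) * |heatKernel t m|
      ≤ C / √t * (1 + (m : ℝ) ^ 2 / t)⁻¹ := by
    intro m
    have h1 : |heatKernel t m| ≤ C * ((1 + (m : ℝ) ^ 2 / t) ^ 2)⁻¹ / √t := by
      rw [le_div_iff₀ hs, mul_comm]; exact h t ht m
    calc _ ≤ (1 + (m : ℝ) ^ 2 / t) * (C * ((1 + (m : ℝ) ^ 2 / t) ^ 2)⁻¹ / √t) := by gcongr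
      _ = _ := by field_simp
  have hsum := (summable_inv_one_add_sq_div ht).mul_left (C / √t)
  have hsum' := hsum.of_nonneg_of_le (fun m => by positivity) hb
  refine ⟨hsum', (hsum'.tsum_le_tsum hb hsum).trans ?_⟩
  rw [tsum_mul_left]
  calc _ ≤ C / √t * (√t * (3 * ∫ y : ℝ, (1 + y ^ 2)⁻¹)) := by
        gcongr
        exact tsum_inv_one_add_sq_div_le ht
    _ = _ := by field_simp

end FloorIntegral

/-! ### Uniqueness of bounded solutions and their kernel representation. -/

noncomputable section HeatSolution

open MeasureTheory AnisoThreshold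

lemma abs_le_of_abs_deriv_le {f f' B B' : ℝ → ℝ} {τ : ℝ} (hf : ContinuousOn f (Icc 0 τ))
    (hf' : ∀ t ∈ Ioc 0 τ, HasDerivWithinAt f (f' t) (Icc 0 τ) t)
    (hB : ∀ t, HasDerivAt B (B' t) t) (hb : ∀ t ∈ Ioc 0 τ, |f' t| ≤ B' t)
    (hf0 : f 0 = 0) (hB0 : B 0 = 0) : ∀ t ∈ Icc 0 τ, |f t| ≤ B t := by
  have hBc : ContinuousOn B (Icc 0 τ) := fun t _ => (hB t).continuousAt.continuousWithinAt
  have hd : ∀ t ∈ interior (Icc 0 τ), HasDerivAt f (f' t) t ∧ |f' t| ≤ B' t := by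
    intro t ht
    rw [interior_Icc] at ht
    exact ⟨(hf' t ⟨ht.1, ht.2.le⟩).hasDerivAt (Icc_mem_nhds ht.1 ht.2), hb t ⟨ht.1, ht.2.le⟩⟩
  have h1 : MonotoneOn (B - f) (Icc 0 τ) :=
    monotoneOn_of_deriv_nonneg (convex_Icc 0 τ) (hBc.sub hf)
      (fun t ht => ((hB t).sub (hd t ht).1).differentiableAt.differentiableWithinAt)
      (fun t ht => by
        rw [((hB t).sub (hd t ht).1).deriv]
        linarith [(abs_le.1 (hd t ht).2).2])
  have h2 : MonotoneOn (B + f) (Icc 0 τ) :=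
    monotoneOn_of_deriv_nonneg (convex_Icc 0 τ) (hBc.add hf)
      (fun t ht => ((hB t).add (hd t ht).1).differentiableAt.differentiableWithinAt)
      (fun t ht => by
        rw [((hB t).add (hd t ht).1).deriv]
        linarith [(abs_le.1 (hd t ht).2).1])
  intro t ht
  have h0 : (0 : ℝ) ∈ Icc 0 τ := ⟨le_rfl, ht.1.trans ht.2⟩
  have a1 := h1 h0 ht ht.1
  have a2 := h2 h0 ht ht.1
  simp only [Pi.sub_apply, Pi.add_apply, hf0, hB0] at a1 a2
  rw [abs_le]
  constructor <;> linarith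

lemma abs_discreteLaplacian_le {h : ℝ} {v : ℤ × ℤ → ℝ} {M : ℝ} (hv : ∀ z, |v z| ≤ M) (z : ℤ × ℤ) :
    |discreteLaplacian h v z| ≤ 8 / h ^ 2 * M := by
  have a1 := abs_le.1 (hv (z.1 + 1, z.2))
  have a2 := abs_le.1 (hv (z.1 - 1, z.2))
  have a3 := abs_le.1 (hv (z.1, z.2 + 1))
  have a4 := abs_le.1 (hv (z.1, z.2 - 1))
  have a5 := abs_le.1 (hv z)
  rw [discreteLaplacian, abs_mul, abs_of_nonneg (by positivity : 0 ≤ 1 / h ^ 2)]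
  calc _ ≤ 1 / h ^ 2 * (8 * M) := by
        refine mul_le_mul_of_nonneg_left ?_ (by positivity)
        rw [abs_le]
        constructor <;> linarith
    _ = _ := by ring

/-- The Laplacian is bounded on bounded functions, with norm at most A = 8/h². Feeding a bound for
the difference back into the equation n times yields a multiple of (At)ⁿ/n!, which tends to 0. -/
lemma isHeatSolution_unique {h τ : ℝ} {u : ℤ × ℤ → ℝ} {w w' : ℝ → ℤ × ℤ → ℝ}
    (hw : IsHeatSolution h τ u w) (hw' : IsHeatSolution h τ u w') :
    ∀ t ∈ Icc 0 τ, ∀ z, w t z = w' t z := by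
  obtain ⟨C1, h1⟩ := hw.bounded
  obtain ⟨C2, h2⟩ := hw'.bounded
  set A := 8 / h ^ 2 with hA
  have key : ∀ n : ℕ, ∀ t ∈ Icc 0 τ, ∀ z,
      |w t z - w' t z| ≤ (C1 + C2) * ((A * t) ^ n / n.factorial) := by
    intro n
    induction n with
    | zero =>
      intro t ht z
      have := abs_sub (w t z) (w' t z)
      simp only [pow_zero, Nat.factorial_zero, Nat.cast_one, div_one, mul_one]
      linarith [h1 t ht z, h2 t ht z]
    | succ n ih =>
      intro t ht z
      refine abs_le_of_abs_deriv_le (f := fun t => w t z - w' t z)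
        (f' := fun t => discreteLaplacian h (w t) z - discreteLaplacian h (w' t) z)
        (B := fun t => (C1 + C2) * ((A * t) ^ (n + 1) / (n + 1).factorial))
        (B' := fun t => A * ((C1 + C2) * ((A * t) ^ n / n.factorial)))
        ((hw.continuousOn z).sub (hw'.continuousOn z))
        (fun t ht => (hw.equation t ht z).sub (hw'.equation t ht z)) (fun t => ?_)
        (fun t ht => ?_) ?_ (by simp) t ht
      · have hd := (((hasDerivAt_id t).const_mul A).pow (n + 1)).div_const
          ((n + 1).factorial : ℝ) |>.const_mul (C1 + C2)
        refine hd.congr_deriv ?_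
        have : (n.factorial : ℝ) ≠ 0 := by positivity
        rw [Nat.factorial_succ]
        push_cast
        simp only [id]
        field_simp
      · have e : discreteLaplacian h (w t) z - discreteLaplacian h (w' t) z
            = discreteLaplacian h (fun z => w t z - w' t z) z := by
          simp only [discreteLaplacian]; ring
        rw [e]
        exact abs_discreteLaplacian_le (ih t ⟨ht.1.le, ht.2⟩) z
      · simp [hw.initial, hw'.initial]
  intro t ht z
  have hlim := (FloorSemiring.tendsto_pow_div_factorial_atTop (A * t)).const_mul (C1 + C2)
  rw [mul_zero] at hlim
  have := ge_of_tendsto' hlim (fun n => key n t ht z)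
  exact sub_eq_zero.1 (abs_nonpos_iff.1 this)

/-- The heat kernel of the five-point Laplacian on `ℤ × ℤ`. -/
def planeHeatKernel (t : ℝ) (z : ℤ × ℤ) : ℝ := heatKernel t z.1 * heatKernel t z.2

/-- The heat semigroup on the grid of mesh size one. -/
def heatSemigroup (t : ℝ) (u : ℤ × ℤ → ℝ) (z : ℤ × ℤ) : ℝ :=
  ∑' z', planeHeatKernel t z' * u (z + z')

lemma planeHeatKernel_neg (t : ℝ) (z : ℤ × ℤ) : planeHeatKernel t (-z) = planeHeatKernel t z := by
  simp [planeHeatKernel, heatKernel_neg]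

lemma exists_planeHeatKernel_bound (T : ℝ) (hT : 0 ≤ T) :
    ∃ b : ℤ × ℤ → ℝ, Summable b ∧ (∀ z, 0 ≤ b z) ∧
      ∀ t, |t| ≤ T → ∀ z, |planeHeatKernel t z| ≤ b z := by
  obtain ⟨g, hg, hg0, h⟩ : ∃ g : ℤ → ℝ, Summable g ∧ (∀ m, 0 ≤ g m) ∧
      ∀ t, |t| ≤ T → ∀ m, |heatKernel t m| ≤ g m := by
    obtain ⟨C, hC, h⟩ := exists_heatKernel_decay T hT
    exact ⟨_, summable_inv_one_add_sq.mul_left C, fun m => by positivity, h⟩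
  refine ⟨fun z => g z.1 * g z.2, hg.mul_of_nonneg hg hg0 hg0,
    fun z => mul_nonneg (hg0 _) (hg0 _), fun t ht z => ?_⟩
  rw [planeHeatKernel, abs_mul]
  exact mul_le_mul (h t ht _) (h t ht _) (abs_nonneg _) (hg0 _)

lemma summable_planeHeatKernel (t : ℝ) : Summable (planeHeatKernel t) := by
  obtain ⟨b, hb, -, h⟩ := exists_planeHeatKernel_bound |t| (abs_nonneg t)
  exact Summable.of_norm_bounded hb (h t le_rfl)

lemma summable_planeHeatKernel_mul (t : ℝ) {f : ℤ × ℤ → ℝ} {B : ℝ} (hf : ∀ z, |f z| ≤ B) :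
    Summable fun z => planeHeatKernel t z * f z := by
  refine Summable.of_norm_bounded ((summable_planeHeatKernel t).norm.mul_right B) fun z => ?_
  rw [norm_mul]
  exact mul_le_mul_of_nonneg_left (hf z) (norm_nonneg _)

lemma hasDerivAt_planeHeatKernel (t : ℝ) (z : ℤ × ℤ) :
    HasDerivAt (fun s => planeHeatKernel s z)
      (planeHeatKernel t (z + (1, 0)) + planeHeatKernel t (z - (1, 0)) +
        planeHeatKernel t (z + (0, 1)) + planeHeatKernel t (z - (0, 1)) -
        4 * planeHeatKernel t z) t := by
  refine ((hasDerivAt_heatKernel t z.1).mul (hasDerivAt_heatKernel t z.2)).congr_deriv ?_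
  simp only [planeHeatKernel, Prod.fst_add, Prod.snd_add, Prod.fst_sub, Prod.snd_sub, add_zero,
    sub_zero]
  ring

lemma tsum_planeHeatKernel_add_mul (t : ℝ) (u : ℤ × ℤ → ℝ) (z e : ℤ × ℤ) :
    ∑' z', planeHeatKernel t (z' + e) * u (z + z') = heatSemigroup t u (z - e) := by
  rw [heatSemigroup,
    ← (Equiv.addRight e).tsum_eq (fun z' => planeHeatKernel t z' * u (z - e + z'))]
  refine tsum_congr fun z' => ?_
  simp only [Equiv.coe_addRight]
  congr 2
  abel

lemma summable_planeHeatKernel_add_mul (t : ℝ) {u : ℤ × ℤ → ℝ} {B : ℝ} (hu : ∀ z, |u z| ≤ B)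
    (z e : ℤ × ℤ) : Summable fun z' => planeHeatKernel t (z' + e) * u (z + z') := by
  have := summable_planeHeatKernel_mul t (f := fun z' => u (z - e + z')) (fun z' => hu _)
  rw [← (Equiv.addRight e).summable_iff] at this
  refine this.congr fun z' => ?_
  simp only [Function.comp, Equiv.coe_addRight]
  congr 2
  abel

/-- Termwise differentiation puts the Laplacian on the kernel; translating the summation index moves
it to the semigroup. -/
lemma hasDerivAt_heatSemigroup {u : ℤ × ℤ → ℝ} {B : ℝ} (hu : ∀ z, |u z| ≤ B) (t : ℝ)
    (z : ℤ × ℤ) :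
    HasDerivAt (fun s => heatSemigroup s u z) (discreteLaplacian 1 (heatSemigroup t u) z) t := by
  obtain ⟨b, hb, hb0, hbK⟩ := exists_planeHeatKernel_bound (|t| + 1) (by positivity)
  have hB : 0 ≤ B := (abs_nonneg _).trans (hu 0)
  have shift : ∀ e : ℤ × ℤ, Summable fun z' => b (z' + e) := fun e =>
    (Equiv.addRight e).summable_iff.2 hb
  have hball : ∀ s ∈ Metric.ball t 1, |s| ≤ |t| + 1 := by
    intro s hs
    rw [Metric.mem_ball, Real.dist_eq] at hs
    have := abs_add_le (s - t) t
    rw [sub_add_cancel] at this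
    linarith
  have hsum : Summable fun z' => (b (z' + (1, 0)) + b (z' + -(1, 0)) + b (z' + (0, 1)) +
      b (z' + -(0, 1)) + 4 * b z') * B :=
    (((((shift _).add (shift _)).add (shift _)).add (shift _)).add (hb.mul_left 4)).mul_right B
  have key := hasDerivAt_tsum_of_isPreconnected (𝕜 := ℝ) hsum Metric.isOpen_ball
    (convex_ball t 1).isPreconnected (y₀ := t) (y := t)
    (g := fun z' s => planeHeatKernel s z' * u (z + z'))
    (fun z' s _ => (hasDerivAt_planeHeatKernel s z').mul_const (u (z + z')))
    (fun z' s hs => ?_) (Metric.mem_ball_self one_pos)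
    (summable_planeHeatKernel_mul t (fun z' => hu _)) (Metric.mem_ball_self one_pos)
  · refine key.congr_deriv ?_
    have hS := summable_planeHeatKernel_add_mul t hu z
    have hT := tsum_planeHeatKernel_add_mul t u z
    have e : ∀ z', (planeHeatKernel t (z' + (1, 0)) + planeHeatKernel t (z' - (1, 0)) +
        planeHeatKernel t (z' + (0, 1)) + planeHeatKernel t (z' - (0, 1)) -
        4 * planeHeatKernel t z') * u (z + z') =
        planeHeatKernel t (z' + (1, 0)) * u (z + z') + planeHeatKernel t (z' + -(1, 0)) * u (z + z')
        + planeHeatKernel t (z' + (0, 1)) * u (z + z')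
        + planeHeatKernel t (z' + -(0, 1)) * u (z + z')
        - 4 * (planeHeatKernel t (z' + 0) * u (z + z')) := by
      intro z'
      rw [sub_eq_add_neg z', sub_eq_add_neg z', add_zero]
      ring
    simp_rw [e]
    rw [Summable.tsum_sub ((((hS _).add (hS _)).add (hS _)).add (hS _)) ((hS _).mul_left 4),
      Summable.tsum_add (((hS _).add (hS _)).add (hS _)) (hS _),
      Summable.tsum_add ((hS _).add (hS _)) (hS _), Summable.tsum_add (hS _) (hS _),
      tsum_mul_left, hT, hT, hT, hT, hT, discreteLaplacian]
    have e1 : z - (1, 0) = (z.1 - 1, z.2) := by ext <;> simp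
    have e2 : z - -(1, 0) = (z.1 + 1, z.2) := by ext <;> simp
    have e3 : z - (0, 1) = (z.1, z.2 - 1) := by ext <;> simp
    have e4 : z - -(0, 1) = (z.1, z.2 + 1) := by ext <;> simp
    rw [e1, e2, e3, e4, sub_zero]
    ring
  · have hK := hbK s (hball s hs)
    rw [norm_mul]
    refine mul_le_mul ?_ (hu _) (norm_nonneg _) ?_
    · rw [Real.norm_eq_abs, sub_eq_add_neg z', sub_eq_add_neg z']
      have a1 := abs_le.1 (hK (z' + (1, 0)))
      have a2 := abs_le.1 (hK (z' + -(1, 0)))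
      have a3 := abs_le.1 (hK (z' + (0, 1)))
      have a4 := abs_le.1 (hK (z' + -(0, 1)))
      have a5 := abs_le.1 (hK z')
      rw [abs_le]
      constructor <;> linarith
    · have a1 := hb0 (z' + (1, 0)); have a2 := hb0 (z' + -(1, 0))
      have a3 := hb0 (z' + (0, 1)); have a4 := hb0 (z' + -(0, 1)); have a5 := hb0 z'
      linarith

lemma heatSemigroup_zero (u : ℤ × ℤ → ℝ) (z : ℤ × ℤ) : heatSemigroup 0 u z = u z := by
  rw [heatSemigroup, tsum_eq_single 0]
  · simp [planeHeatKernel, heatKernel_zero]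
  · intro z' hz'
    simp only [planeHeatKernel, heatKernel_zero]
    by_cases h1 : z'.1 = 0
    · have h2 : z'.2 ≠ 0 := fun h2 => hz' (Prod.ext h1 h2)
      simp [h2]
    · simp [h1]

lemma isHeatSolution_heatSemigroup {h τ : ℝ} {u : ℤ × ℤ → ℝ} {B : ℝ}
    (hu : ∀ z, |u z| ≤ B) : IsHeatSolution h τ u (fun t z => heatSemigroup (t / h ^ 2) u z) := by
  have hd : ∀ t z, HasDerivAt (fun t => heatSemigroup (t / h ^ 2) u z)
      (discreteLaplacian h (heatSemigroup (t / h ^ 2) u) z) t := by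
    intro t z
    have h1 : HasDerivAt (fun t : ℝ => t / h ^ 2) (1 / h ^ 2) t := (hasDerivAt_id t).div_const _
    refine ((hasDerivAt_heatSemigroup hu (t / h ^ 2) z).comp t h1).congr_deriv ?_
    simp only [discreteLaplacian]
    ring
  refine ⟨fun z => by simp [heatSemigroup_zero], fun z t _ =>
    (hd t z).continuousAt.continuousWithinAt, fun t _ z => (hd t z).hasDerivWithinAt, ?_⟩
  obtain ⟨b, hb, hb0, hbK⟩ := exists_planeHeatKernel_bound (|τ| / h ^ 2) (by positivity)
  refine ⟨∑' z', b z' * B, fun t ht z => ?_⟩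
  have ht' : |t / h ^ 2| ≤ |τ| / h ^ 2 := by
    rw [abs_div, abs_of_nonneg (by positivity : 0 ≤ h ^ 2), abs_of_nonneg ht.1]
    gcongr
    exact ht.2.trans (le_abs_self τ)
  rw [← Real.norm_eq_abs, heatSemigroup]
  refine tsum_of_norm_bounded (hb.mul_right B).hasSum fun z' => ?_
  rw [norm_mul]
  exact mul_le_mul (hbK _ ht' z') (hu _) (norm_nonneg _) (hb0 _)

/-- Representation of bounded solutions by the heat semigroup. -/
lemma eq_heatSemigroup {h τ : ℝ} {u : ℤ × ℤ → ℝ} {B : ℝ} (hu : ∀ z, |u z| ≤ B)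
    {w : ℝ → ℤ × ℤ → ℝ} (hw : IsHeatSolution h τ u w) (hτ : 0 ≤ τ) (z : ℤ × ℤ) :
    w τ z = heatSemigroup (τ / h ^ 2) u z :=
  isHeatSolution_unique hw (isHeatSolution_heatSemigroup hu) τ ⟨hτ, le_rfl⟩ z

/-- The constant 1 is a bounded solution, so uniqueness identifies it with its own kernel
representation. -/
lemma tsum_planeHeatKernel {t : ℝ} (ht : 0 ≤ t) : ∑' z, planeHeatKernel t z = 1 := by
  have h1 : IsHeatSolution 1 t (fun _ => 1) (fun _ _ => 1) :=
    ⟨fun _ => rfl, fun _ => continuousOn_const, fun s _ z => by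
      have : discreteLaplacian 1 (fun _ => 1) z = 0 := by simp [discreteLaplacian]; norm_num
      rw [this]
      exact hasDerivWithinAt_const _ _ _, 1, fun _ _ _ => by simp⟩
  have := eq_heatSemigroup (B := 1) (fun _ => by simp) h1 ht 0
  simpa [heatSemigroup] using this.symm

end HeatSolution

/-! ### Lattice lines parallel to the tangent, and the ordering of the strip. -/

noncomputable section LatticeLines

open AnisoThreshold

/-- The lattice lines parallel to `y = (p / q) x` are the level sets of this linear form. -/
def lineIndex (p q : ℕ) (z : ℤ × ℤ) : ℤ := p * z.1 - q * z.2

lemma lineIndex_neg (p q : ℕ) (z : ℤ × ℤ) : lineIndex p q (-z) = -lineIndex p q z := by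
  simp [lineIndex]; ring

lemma lineIndex_sub (p q : ℕ) (z z' : ℤ × ℤ) :
    lineIndex p q (z - z') = lineIndex p q z - lineIndex p q z' := by
  simp [lineIndex]; ring

lemma exists_lineIndex_eq {p q : ℕ} (hq : 0 < q) (hcop : Nat.Coprime p q) (k : ℤ) :
    ∃ z : ℤ × ℤ, 0 ≤ z.1 ∧ z.1 < q ∧ lineIndex p q z = k := by
  obtain ⟨a, b, hab⟩ := (Nat.isCoprime_iff_coprime.2 hcop : IsCoprime (p : ℤ) (q : ℤ))
  have hq' : (0 : ℤ) < q := by exact_mod_cast hq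
  -- The Bézout solution k·(a, −b), translated along (q, p) to bring the first coordinate into [0,
  -- q).
  refine ⟨((k * a) % q, -(k * b) - p * (k * a / q)), Int.emod_nonneg _ hq'.ne',
    Int.emod_lt_of_pos _ hq', ?_⟩
  have h := Int.emod_add_mul_ediv (k * a) q
  simp only [lineIndex]
  linear_combination (p : ℤ) * h + k * hab

lemma exists_eq_mul_of_lineIndex_eq_zero {p q : ℕ} (hq : 0 < q) (hcop : Nat.Coprime p q)
    {z : ℤ × ℤ} (hz : lineIndex p q z = 0) : ∃ i : ℤ, z = (i * q, i * p) := by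
  have hc : IsCoprime (q : ℤ) (p : ℤ) := (Nat.isCoprime_iff_coprime.2 hcop).symm
  have h1 : (p : ℤ) * z.1 = q * z.2 := sub_eq_zero.1 hz
  obtain ⟨i, hi⟩ := hc.dvd_of_dvd_mul_left (⟨z.2, h1⟩ : (q : ℤ) ∣ p * z.1)
  have hq' : (q : ℤ) ≠ 0 := by exact_mod_cast hq.ne'
  refine ⟨i, Prod.ext (by rw [hi, mul_comm]) (mul_left_cancel₀ hq' ?_)⟩
  rw [← h1, hi]
  ring

/-- A point on the lattice line of index `k`, with first coordinate in `[0, q)`. -/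
def lineBase {p q : ℕ} (hq : 0 < q) (hcop : Nat.Coprime p q) (k : ℤ) : ℤ × ℤ :=
  (exists_lineIndex_eq hq hcop k).choose

/-- The point number `i` on the lattice line of index `k`. -/
def linePoint {p q : ℕ} (hq : 0 < q) (hcop : Nat.Coprime p q) (i k : ℤ) : ℤ × ℤ :=
  lineBase hq hcop k + (i * q, i * p)

section

variable {p q : ℕ} (hq : 0 < q) (hcop : Nat.Coprime p q)

lemma lineBase_fst_nonneg (k : ℤ) : 0 ≤ (lineBase hq hcop k).1 :=
  (exists_lineIndex_eq hq hcop k).choose_spec.1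

lemma lineBase_fst_lt (k : ℤ) : (lineBase hq hcop k).1 < q :=
  (exists_lineIndex_eq hq hcop k).choose_spec.2.1

lemma lineIndex_lineBase (k : ℤ) : lineIndex p q (lineBase hq hcop k) = k :=
  (exists_lineIndex_eq hq hcop k).choose_spec.2.2

lemma lineIndex_linePoint (i k : ℤ) : lineIndex p q (linePoint hq hcop i k) = k := by
  have := lineIndex_lineBase hq hcop k
  simp only [lineIndex, linePoint, Prod.fst_add, Prod.snd_add] at this ⊢
  linear_combination this

lemma linePoint_bijective :
    Function.Bijective fun x : ℤ × ℤ => linePoint hq hcop x.1 x.2 := by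
  have hq' : (q : ℤ) ≠ 0 := by exact_mod_cast hq.ne'
  constructor
  · intro x y hxy
    simp only at hxy
    have h2 : x.2 = y.2 := by
      rw [← lineIndex_linePoint hq hcop x.1 x.2, hxy, lineIndex_linePoint]
    rw [linePoint, linePoint, h2] at hxy
    have h1 := congrArg Prod.fst (add_left_cancel hxy)
    exact Prod.ext (mul_right_cancel₀ hq' h1) h2
  · intro z
    obtain ⟨i, hi⟩ := exists_eq_mul_of_lineIndex_eq_zero hq hcop
      (z := z - lineBase hq hcop (lineIndex p q z))
      (by rw [lineIndex_sub, lineIndex_lineBase, sub_self])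
    exact ⟨(i, lineIndex p q z), by simp only [linePoint]; rw [← hi]; abel⟩

/-- The points of `ℤ × ℤ`, sorted by lattice lines and seen from `z₀`. -/
def lineEquiv (z₀ : ℤ × ℤ) : ℤ × ℤ ≃ ℤ × ℤ :=
  (Equiv.ofBijective _ (linePoint_bijective hq hcop)).trans (Equiv.subRight z₀)

lemma lineEquiv_apply (z₀ x : ℤ × ℤ) :
    lineEquiv hq hcop z₀ x = linePoint hq hcop x.1 x.2 - z₀ := rfl

end

lemma mem_strip_iff {p q : ℕ} (hq : 0 < q) {z : ℤ × ℤ} :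
    z ∈ strip p q ↔ 0 ≤ z.1 ∧ z.1 < q ∧ 0 < lineIndex p q z := by
  have hq' : (0 : ℝ) < q := by exact_mod_cast hq
  have h : (z.2 : ℝ) < (p : ℝ) / q * z.1 ↔ 0 < lineIndex p q z := by
    rw [div_mul_eq_mul_div, lt_div_iff₀ hq', lineIndex, sub_pos]
    constructor
    · intro h; rw [mul_comm]; exact_mod_cast h
    · intro h; rw [mul_comm]; exact_mod_cast h
  simp only [strip, mem_ofPred_eq, h]
  constructor
  · rintro ⟨a, b, c⟩; exact ⟨a, by omega, c⟩
  · rintro ⟨a, b, c⟩; exact ⟨a, by omega, c⟩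

lemma lineDist_eq {p q : ℕ} (z : ℤ × ℤ) :
    lineDist p q z = |(lineIndex p q z : ℝ)| / √((p : ℝ) ^ 2 + (q : ℝ) ^ 2) := by
  rw [lineDist, lineIndex, ← abs_neg]
  push_cast
  ring_nf

/-- The strip meets every lattice line of positive index, and distance to the tangent is
proportional to the index. Hence the indices of P 1, P 2, … increase strictly and exhaust 1, 2, 3,
…, which determines them. -/
lemma lineIndex_stripOrdering {p q : ℕ} (hq : 0 < q) (hcop : Nat.Coprime p q) {P : ℕ → ℤ × ℤ}
    (hP : IsStripOrdering p q P) (i : ℕ) : lineIndex p q (P i) = i := by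
  have hq' : (0 : ℝ) < q := by exact_mod_cast hq
  have hℓ : 0 < √((p : ℝ) ^ 2 + (q : ℝ) ^ 2) := by positivity
  have hpos : ∀ n, 0 < lineIndex p q (P (n + 1)) := fun n =>
    ((mem_strip_iff hq).1 (hP.bijOn.mapsTo (by simp : n + 1 ∈ Ici 1))).2.2
  have hmono : StrictMono fun n => (lineIndex p q (P (n + 1))).toNat := by
    intro m n hmn
    have h := hP.strictMonoOn (by simp : m + 1 ∈ Ici 1) (by simp : n + 1 ∈ Ici 1)
      (Nat.add_lt_add_right hmn 1)
    simp only [lineDist_eq] at h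
    rw [div_lt_div_iff_of_pos_right hℓ, ← Int.cast_abs, ← Int.cast_abs, Int.cast_lt,
      abs_of_pos (hpos m), abs_of_pos (hpos n)] at h
    have := hpos m
    simp only
    omega
  have hrange : range (fun n => (lineIndex p q (P (n + 1))).toNat) = range Nat.succ := by
    ext k
    constructor
    · rintro ⟨n, rfl⟩
      have := hpos n
      exact ⟨(lineIndex p q (P (n + 1))).toNat - 1, by simp only; omega⟩
    · rintro ⟨k, rfl⟩
      have hm : lineBase hq hcop (k + 1) ∈ strip p q := by
        rw [mem_strip_iff hq, lineIndex_lineBase]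
        exact ⟨lineBase_fst_nonneg _ _ _, lineBase_fst_lt _ _ _, by omega⟩
      obtain ⟨n, hn, hPn⟩ := hP.bijOn.surjOn hm
      obtain ⟨n, rfl⟩ : ∃ n', n = n' + 1 := ⟨n - 1, by have : 1 ≤ n := hn; omega⟩
      refine ⟨n, ?_⟩
      simp only [hPn, lineIndex_lineBase]
      omega
  have heq := (hmono.range_inj Order.succ_strictMono).1 hrange
  cases i with
  | zero => simp [hP.zero, lineIndex]
  | succ n =>
    have h := congrFun heq n
    have := hpos n
    simp only [Order.succ_eq_add_one] at h
    push_cast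
    omega

lemma lineDist_stripOrdering {p q : ℕ} (hq : 0 < q) (hcop : Nat.Coprime p q) {P : ℕ → ℤ × ℤ}
    (hP : IsStripOrdering p q P) (i : ℕ) :
    lineDist p q (P i) = i / √((p : ℝ) ^ 2 + (q : ℝ) ^ 2) := by
  rw [lineDist_eq, lineIndex_stripOrdering hq hcop hP]
  simp

end LatticeLines

/-! ### The exact value 1/2 for half planes, and the far-field estimate. -/

noncomputable section HalfPlane

open AnisoThreshold

/-- The Heaviside function with value `1 / 2` at the origin. -/
def heaviside (k : ℤ) : ℝ := if 0 < k then 1 else if k = 0 then 1 / 2 else 0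

lemma heaviside_add_neg (k : ℤ) : heaviside k + heaviside (-k) = 1 := by
  simp only [heaviside, neg_eq_zero, Left.neg_pos_iff]
  rcases lt_trichotomy k 0 with h | h | h
  · simp [h, h.ne, h.not_gt]
  · simp [h]; norm_num
  · simp [h, h.ne', h.not_gt]

lemma heaviside_nonneg (k : ℤ) : 0 ≤ heaviside k := by
  rw [heaviside]; split_ifs <;> norm_num

lemma heaviside_le_one (k : ℤ) : heaviside k ≤ 1 := by
  rw [heaviside]; split_ifs <;> norm_num

/-- Reflection z ↦ −z preserves the kernel and exchanges the two half planes, whose weighted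
indicators add up to 1; the value 1/2 on the boundary line makes this exact. -/
lemma tsum_planeHeatKernel_mul_heaviside (p q : ℕ) {t : ℝ} (ht : 0 ≤ t) :
    ∑' z, planeHeatKernel t z * heaviside (lineIndex p q z) = 1 / 2 := by
  have hs := fun k : ℤ × ℤ → ℤ => summable_planeHeatKernel_mul t (f := fun z => heaviside (k z))
    (B := 1) (fun z => by rw [abs_of_nonneg (heaviside_nonneg _)]; exact heaviside_le_one _)
  have h1 : ∑' z, planeHeatKernel t z * heaviside (lineIndex p q z) =
      ∑' z, planeHeatKernel t z * heaviside (-lineIndex p q z) := by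
    rw [← (Equiv.neg (ℤ × ℤ)).tsum_eq]
    simp [planeHeatKernel_neg, lineIndex_neg]
  have h2 : ∑' z, planeHeatKernel t z * heaviside (lineIndex p q z) +
      ∑' z, planeHeatKernel t z * heaviside (-lineIndex p q z) = 1 := by
    rw [← Summable.tsum_add (hs _) (hs _), ← tsum_planeHeatKernel ht]
    refine tsum_congr fun z => ?_
    rw [← mul_add, heaviside_add_neg, mul_one]
  linarith

/-- The mass of the heat kernel far away from the origin. -/
lemma exists_planeHeatKernel_tail_bound :
    ∃ C, 0 ≤ C ∧ ∀ t, 1 ≤ t → ∀ ρ, 0 < ρ → ∀ F : ℤ × ℤ → ℝ, (∀ z, |F z| ≤ 1) →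
      (∀ z, |(z.1 : ℝ)| < ρ → |(z.2 : ℝ)| < ρ → F z = 0) →
      |∑' z, planeHeatKernel t z * F z| ≤ C * (t / ρ ^ 2) := by
  obtain ⟨C, hC, h⟩ := exists_heatKernel_moment_bound
  refine ⟨C * C, by positivity, fun t ht ρ hρ F hF hF0 => ?_⟩
  obtain ⟨hs, hle⟩ := h t ht
  have ht0 : 0 < t := by linarith
  have hn : ∀ m : ℤ, 0 ≤ (1 + (m : ℝ) ^ 2 / t) * |heatKernel t m| := fun m => by positivity
  set g : ℤ → ℝ := fun m => (1 + (m : ℝ) ^ 2 / t) * |heatKernel t m| with hg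
  have hsum : Summable fun z : ℤ × ℤ => g z.1 * g z.2 := hs.mul_of_nonneg hs hn hn
  have htot : ∑' z : ℤ × ℤ, g z.1 * g z.2 ≤ C * C := by
    rw [← hs.tsum_mul_tsum hs hsum]
    exact mul_le_mul hle hle (tsum_nonneg hn) hC
  rw [← Real.norm_eq_abs]
  refine (tsum_of_norm_bounded (hsum.mul_right (t / ρ ^ 2)).hasSum fun z => ?_).trans ?_
  · by_cases hz : |(z.1 : ℝ)| < ρ ∧ |(z.2 : ℝ)| < ρ
    · rw [hF0 z hz.1 hz.2]
      simpa using mul_nonneg (mul_nonneg (hn z.1) (hn z.2)) (by positivity)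
    · have hone : ∀ m : ℤ, 1 ≤ 1 + (m : ℝ) ^ 2 / t := fun m => by
        have : 0 ≤ (m : ℝ) ^ 2 / t := by positivity
        linarith
      have hfar : ∀ m : ℤ, ρ ≤ |(m : ℝ)| → 1 ≤ (1 + (m : ℝ) ^ 2 / t) * (t / ρ ^ 2) := by
        intro m hm
        have h1 : ρ ^ 2 ≤ (m : ℝ) ^ 2 := by rw [← sq_abs (m : ℝ)]; gcongr
        have h2 : (m : ℝ) ^ 2 / t * (t / ρ ^ 2) = (m : ℝ) ^ 2 / ρ ^ 2 := by field_simp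
        have h3 : 1 ≤ (m : ℝ) ^ 2 / ρ ^ 2 := by rwa [one_le_div (by positivity)]
        have h4 : 0 ≤ t / ρ ^ 2 := by positivity
        rw [add_mul, h2]
        linarith
      -- A Chebyshev argument: outside the square one coordinate is at least ρ, and the factor of
      -- the other coordinate is at least 1.
      have hw : 1 ≤ (1 + (z.1 : ℝ) ^ 2 / t) * (1 + (z.2 : ℝ) ^ 2 / t) * (t / ρ ^ 2) := by
        have a1 := hone z.1
        have a2 := hone z.2
        rw [not_and_or, not_lt, not_lt] at hz
        rcases hz with hz | hz
        · have := hfar z.1 hz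
          nlinarith
        · have := hfar z.2 hz
          nlinarith
      rw [norm_mul, Real.norm_eq_abs, Real.norm_eq_abs, planeHeatKernel, abs_mul]
      have hk : 0 ≤ |heatKernel t z.1| * |heatKernel t z.2| := by positivity
      calc _ ≤ |heatKernel t z.1| * |heatKernel t z.2| * 1 := mul_le_mul_of_nonneg_left (hF z) hk
        _ ≤ |heatKernel t z.1| * |heatKernel t z.2| *
            ((1 + (z.1 : ℝ) ^ 2 / t) * (1 + (z.2 : ℝ) ^ 2 / t) * (t / ρ ^ 2)) :=
          mul_le_mul_of_nonneg_left hw hk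
        _ = _ := by simp only [hg]; ring
  · rw [tsum_mul_right]
    gcongr

end HalfPlane

/-! ### The local defect: support, domination and pointwise limits along lattice lines. -/

noncomputable section Asymptotics

open MeasureTheory AnisoThreshold

/-- The difference between the data `u` and the half-plane bounded by the lattice line of index `n`,
cut off outside the square of half side `c`. -/
def localDefect (p q : ℕ) (c : ℝ) (n : ℤ) (h : ℝ) (u : ℤ × ℤ → ℝ) (z : ℤ × ℤ) : ℝ :=
  if |(z.1 : ℝ) * h| < c ∧ |(z.2 : ℝ) * h| < c then u z - heaviside (lineIndex p q z - n) else 0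

/-- In the square of half side `c`, the data `u` on the grid of mesh size `h` is the indicator of the
region below a parabola of slope `p / q`. -/
def IsParabolicDatum (p q : ℕ) (b c h : ℝ) (u : ℤ × ℤ → ℝ) : Prop :=
  (∀ z, 0 ≤ u z ∧ u z ≤ 1) ∧
    ∀ z : ℤ × ℤ, |(z.1 : ℝ) * h| < c → |(z.2 : ℝ) * h| < c →
      (b * h * (z.1 : ℝ) ^ 2 < lineIndex p q z → u z = 1) ∧
      (lineIndex p q z < b * h * (z.1 : ℝ) ^ 2 → u z = 0)

/-- The limit of the local defect along the lattice line of index `k`, at the rescaled position `y`. -/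
def limitDefect (a : ℝ) (n k : ℕ) (y : ℝ) : ℝ :=
  (if a * y ^ 2 < k then 1 else 0) - heaviside ((k : ℤ) - n)

lemma tendsto_div_nhdsGT_zero {μ : ℝ} (hμ : 0 < μ) :
    Tendsto (fun h : ℝ => μ / h) (𝓝[>] (0 : ℝ)) atTop := by
  simpa [div_eq_mul_inv] using tendsto_inv_nhdsGT_zero.const_mul_atTop hμ

lemma abs_sub_heaviside_le {x : ℝ} (hx : 0 ≤ x ∧ x ≤ 1) (k : ℤ) : |x - heaviside k| ≤ 1 := by
  have h1 := heaviside_nonneg k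
  have h2 := heaviside_le_one k
  rw [abs_le]
  constructor <;> linarith [hx.1, hx.2]

lemma abs_localDefect_le {p q : ℕ} {b c h : ℝ} {u : ℤ × ℤ → ℝ} (hu : IsParabolicDatum p q b c h u)
    (n : ℤ) (z : ℤ × ℤ) : |localDefect p q c n h u z| ≤ 1 := by
  rw [localDefect]
  split_ifs
  · exact abs_sub_heaviside_le (hu.1 z) _
  · simp

/-- Above the tangent both data vanish; on lines beyond both n and the parabola both equal 1. -/
lemma lineIndex_mem_of_localDefect_ne_zero {p q : ℕ} {b c h : ℝ} {u : ℤ × ℤ → ℝ}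
    (hu : IsParabolicDatum p q b c h u) (hb : 0 ≤ b * h) {n : ℕ} {z : ℤ × ℤ}
    (hz : localDefect p q c n h u z ≠ 0) :
    0 ≤ lineIndex p q z ∧ (lineIndex p q z : ℝ) ≤ n + b * h * (z.1 : ℝ) ^ 2 := by
  rw [localDefect] at hz
  split_ifs at hz with hsq
  · obtain ⟨h1, h0⟩ := hu.2 z hsq.1 hsq.2
    have hm : 0 ≤ b * h * (z.1 : ℝ) ^ 2 := by positivity
    constructor
    · by_contra hneg
      rw [not_le] at hneg
      have : (lineIndex p q z : ℝ) < 0 := by exact_mod_cast hneg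
      apply hz
      rw [h0 (by linarith), heaviside, if_neg (by omega), if_neg (by omega), sub_zero]
    · by_contra hbig
      rw [not_le] at hbig
      have hn : (0 : ℝ) ≤ n := n.cast_nonneg
      have h2 : ((n : ℤ) : ℝ) < lineIndex p q z := by push_cast; linarith
      rw [Int.cast_lt] at h2
      apply hz
      rw [h1 (by linarith), heaviside, if_pos (by omega), sub_self]
  · exact absurd rfl hz

section

variable {p q : ℕ} (hq : 0 < q) (hcop : Nat.Coprime p q)

/-- The offset of the base point and the rounding by the floor each cost at most q. -/
lemma abs_linePoint_fst_sub_le {s : ℝ} (hs : 0 < s) (y : ℝ) (k : ℤ) :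
    |((linePoint hq hcop ⌊y * s⌋ k).1 : ℝ) / s - q * y| ≤ 2 * q / s := by
  have h1 : (0 : ℝ) ≤ (lineBase hq hcop k).1 := by exact_mod_cast lineBase_fst_nonneg hq hcop k
  have h2 : ((lineBase hq hcop k).1 : ℝ) < q := by exact_mod_cast lineBase_fst_lt hq hcop k
  have h3 := Int.floor_le (y * s)
  have h4 := Int.lt_floor_add_one (y * s)
  have hq' : (0 : ℝ) < q := by exact_mod_cast hq
  have e : ((linePoint hq hcop ⌊y * s⌋ k).1 : ℝ) / s - q * y
      = ((lineBase hq hcop k).1 - q * (y * s - ⌊y * s⌋)) / s := by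
    simp only [linePoint, Prod.fst_add]
    push_cast
    field_simp
    ring
  rw [e, abs_div, abs_of_pos hs]
  gcongr
  have h5 : 0 ≤ q * (y * s - ⌊y * s⌋) := by apply mul_nonneg hq'.le; linarith
  have h6 : q * (y * s - ⌊y * s⌋) ≤ q * 1 := by gcongr; linarith
  rw [abs_le]
  constructor <;> linarith

lemma linePoint_snd (i k : ℤ) :
    ((linePoint hq hcop i k).2 : ℝ) = (p * (linePoint hq hcop i k).1 - k) / q := by
  have hq' : (q : ℝ) ≠ 0 := by exact_mod_cast hq.ne'
  have h : ((lineIndex p q (linePoint hq hcop i k) : ℤ) : ℝ) = k := by rw [lineIndex_linePoint]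
  rw [lineIndex] at h
  push_cast at h
  rw [← h]
  field_simp
  ring

lemma sq_linePoint_fst_le {t : ℝ} (ht : 1 ≤ t) (y : ℝ) (k : ℤ) :
    ((linePoint hq hcop ⌊y * √t⌋ k).1 : ℝ) ^ 2 ≤ t * ((q : ℝ) ^ 2 * (2 * y ^ 2 + 8)) := by
  have ht0 : 0 < t := by linarith
  have hs : 1 ≤ √t := Real.one_le_sqrt.2 ht
  have hs0 : 0 < √t := by linarith
  have h := abs_linePoint_fst_sub_le hq hcop hs0 y k
  set m : ℝ := ((linePoint hq hcop ⌊y * √t⌋ k).1 : ℝ)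
  have hq' : (0 : ℝ) < q := by exact_mod_cast hq
  have h2 : 2 * (q : ℝ) / √t ≤ 2 * q := div_le_self (by positivity) hs
  have h3 := abs_le.1 (h.trans h2)
  have h4 : (m / √t) ^ 2 ≤ (q : ℝ) ^ 2 * (2 * y ^ 2 + 8) := by
    have : (m / √t - q * y) ^ 2 ≤ (2 * q) ^ 2 := sq_le_sq' (by linarith) h3.2
    nlinarith [sq_nonneg (m / √t - 2 * (q * y))]
  rw [div_pow, Real.sq_sqrt ht0.le, div_le_iff₀ ht0] at h4
  linarith

lemma localDefect_linePoint_eq_zero {b c h μ : ℝ} {u : ℤ × ℤ → ℝ}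
    (hu : IsParabolicDatum p q b c h u) (hb : 0 < b) (hh : 0 < h) (ht : 1 ≤ μ / h) (n : ℕ)
    (y : ℝ) (k : ℤ)
    (hk : k < 0 ∨ (n : ℝ) + b * μ * q ^ 2 * (2 * y ^ 2 + 8) < k) :
    localDefect p q c n h u (linePoint hq hcop ⌊y * √(μ / h)⌋ k) = 0 := by
  by_contra hne
  obtain ⟨h1, h2⟩ := lineIndex_mem_of_localDefect_ne_zero hu (by positivity) hne
  rw [lineIndex_linePoint] at h1 h2
  rcases hk with hk | hk
  · omega
  · have h3 := sq_linePoint_fst_le hq hcop ht y k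
    have h4 : b * h * ((linePoint hq hcop ⌊y * √(μ / h)⌋ k).1 : ℝ) ^ 2
        ≤ b * h * (μ / h * ((q : ℝ) ^ 2 * (2 * y ^ 2 + 8))) := by gcongr
    have h5 : b * h * (μ / h * ((q : ℝ) ^ 2 * (2 * y ^ 2 + 8))) =
        b * μ * q ^ 2 * (2 * y ^ 2 + 8) := by field_simp
    linarith

/-- The first coordinate alone supplies the decay in y; the second factor is merely bounded. The
exponent 2 leaves an integrable bound after summation over O(1 + y²) lines. -/
lemma exists_mul_planeHeatKernel_linePoint_le (z₀ : ℤ × ℤ) :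
    ∃ C, 0 ≤ C ∧ ∀ t, 1 ≤ t → ∀ (y : ℝ) (k : ℤ),
      t * |planeHeatKernel t (linePoint hq hcop ⌊y * √t⌋ k - z₀)| ≤ C * ((1 + y ^ 2)⁻¹) ^ 2 := by
  obtain ⟨C, hC, hker⟩ := exists_heatKernel_scaled_decay
  set D : ℝ := 2 * q + |(z₀.1 : ℝ)| with hD
  have hD0 : 0 ≤ D := by positivity
  refine ⟨C * C * (2 + 2 * D ^ 2) ^ 2, by positivity, fun t ht y k => ?_⟩
  have ht0 : 0 < t := by linarith
  have hs : 1 ≤ √t := Real.one_le_sqrt.2 ht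
  have hs0 : 0 < √t := by linarith
  have hq' : (1 : ℝ) ≤ q := by exact_mod_cast hq
  have h := abs_linePoint_fst_sub_le hq hcop hs0 y k
  set z := linePoint hq hcop ⌊y * √t⌋ k
  have h1 := hker t ht (z - z₀).1
  have h2 := hker t ht (z - z₀).2
  have h2' : √t * |heatKernel t (z - z₀).2| ≤ C := by
    refine h2.trans ?_
    have : ((1 + ((z - z₀).2 : ℝ) ^ 2 / t) ^ 2)⁻¹ ≤ 1 := by
      apply inv_le_one_of_one_le₀
      have : 0 ≤ ((z - z₀).2 : ℝ) ^ 2 / t := by positivity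
      nlinarith
    nlinarith
  have h3 : 1 + y ^ 2 ≤ (2 + 2 * D ^ 2) * (1 + ((z - z₀).1 : ℝ) ^ 2 / t) := by
    have e : ((z - z₀).1 : ℝ) ^ 2 / t = (((z - z₀).1 : ℝ) / √t) ^ 2 := by
      rw [div_pow, Real.sq_sqrt ht0.le]
    have e2 : ((z - z₀).1 : ℝ) / √t - q * y = (z.1 / √t - q * y) + -(z₀.1 / √t) := by
      rw [Prod.fst_sub]; push_cast; ring
    have h4 : |((z - z₀).1 : ℝ) / √t - q * y| ≤ D := by
      rw [e2, hD]
      refine (abs_add_le _ _).trans (add_le_add (h.trans (div_le_self (by positivity) hs)) ?_)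
      rw [abs_neg, abs_div, abs_of_pos hs0]
      exact div_le_self (abs_nonneg _) hs
    rw [e]
    set x : ℝ := ((z - z₀).1 : ℝ) / √t
    have h5 : (x - q * y) ^ 2 ≤ D ^ 2 := sq_le_sq' (abs_le.1 h4).1 (abs_le.1 h4).2
    have h6 : y ^ 2 ≤ (q * y) ^ 2 := by
      rw [mul_pow]
      exact le_mul_of_one_le_left (sq_nonneg y) (one_le_pow₀ hq')
    nlinarith [sq_nonneg (2 * x - q * y), mul_nonneg (sq_nonneg D) (sq_nonneg x)]
  have h3' : ((1 + ((z - z₀).1 : ℝ) ^ 2 / t) ^ 2)⁻¹ ≤ (2 + 2 * D ^ 2) ^ 2 * ((1 + y ^ 2)⁻¹) ^ 2 := by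
    rw [inv_pow, ← div_eq_mul_inv, inv_eq_one_div, div_le_div_iff₀ (by positivity) (by positivity),
      one_mul, ← mul_pow]
    gcongr
  have hst : √t * √t = t := Real.mul_self_sqrt ht0.le
  calc t * |planeHeatKernel t (z - z₀)|
      = (√t * |heatKernel t (z - z₀).1|) * (√t * |heatKernel t (z - z₀).2|) := by
        rw [planeHeatKernel, abs_mul]
        linear_combination (-|heatKernel t (z - z₀).1| * |heatKernel t (z - z₀).2|) * hst
    _ ≤ (C * ((1 + ((z - z₀).1 : ℝ) ^ 2 / t) ^ 2)⁻¹) * C := by gcongr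
    _ ≤ (C * ((2 + 2 * D ^ 2) ^ 2 * ((1 + y ^ 2)⁻¹) ^ 2)) * C := by gcongr
    _ = _ := by ring

lemma tendsto_linePoint_fst_div {ι : Type*} {l : Filter ι} {s : ι → ℝ} (hs : Tendsto s l atTop)
    (y : ℝ) (k : ℤ) :
    Tendsto (fun i => ((linePoint hq hcop ⌊y * s i⌋ k).1 : ℝ) / s i) l (𝓝 (q * y)) := by
  rw [tendsto_iff_norm_sub_tendsto_zero]
  refine squeeze_zero' (Eventually.of_forall fun _ => norm_nonneg _) ?_
    (hs.const_div_atTop (2 * (q : ℝ)))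
  filter_upwards [hs.eventually_gt_atTop 0] with i hi
  exact abs_linePoint_fst_sub_le hq hcop hi y k

lemma tendsto_linePoint_snd_div {ι : Type*} {l : Filter ι} {s : ι → ℝ} (hs : Tendsto s l atTop)
    (y : ℝ) (k : ℤ) :
    Tendsto (fun i => ((linePoint hq hcop ⌊y * s i⌋ k).2 : ℝ) / s i) l (𝓝 (p * y)) := by
  have hq' : (q : ℝ) ≠ 0 := by exact_mod_cast hq.ne'
  have h := (((tendsto_linePoint_fst_div hq hcop hs y k).const_mul (p : ℝ)).sub
    (hs.const_div_atTop (k : ℝ))).div_const (q : ℝ)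
  have e : (p * (q * y) - 0) / (q : ℝ) = p * y := by field_simp; ring
  rw [e] at h
  refine h.congr fun i => ?_
  rw [linePoint_snd]
  ring

/-- On scale √t all fixed lattice lines collapse onto the tangent, so the limit depends neither on k
nor on z₀; the two Gaussians combine through (qy)² + (py)². -/
lemma tendsto_mul_planeHeatKernel_linePoint {ι : Type*} {l : Filter ι} [l.IsCountablyGenerated]
    {t : ι → ℝ} (ht : Tendsto t l atTop) (z₀ : ℤ × ℤ) (y : ℝ) (k : ℤ) :
    Tendsto (fun i => t i * planeHeatKernel (t i) (linePoint hq hcop ⌊y * √(t i)⌋ k - z₀)) l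
      (𝓝 ((4 * Real.pi)⁻¹ * Real.exp (-((p : ℝ) ^ 2 + q ^ 2) * y ^ 2 / 4))) := by
  have hpi := Real.pi_pos
  have hs : Tendsto (fun i => √(t i)) l atTop := Real.tendsto_sqrt_atTop.comp ht
  have h1 : Tendsto (fun i => (((linePoint hq hcop ⌊y * √(t i)⌋ k - z₀).1 : ℤ) : ℝ) / √(t i)) l
      (𝓝 (q * y)) := by
    have := (tendsto_linePoint_fst_div hq hcop hs y k).sub (hs.const_div_atTop (z₀.1 : ℝ))
    rw [sub_zero] at this
    refine this.congr fun i => ?_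
    rw [Prod.fst_sub]; push_cast; ring
  have h2 : Tendsto (fun i => (((linePoint hq hcop ⌊y * √(t i)⌋ k - z₀).2 : ℤ) : ℝ) / √(t i)) l
      (𝓝 (p * y)) := by
    have := (tendsto_linePoint_snd_div hq hcop hs y k).sub (hs.const_div_atTop (z₀.2 : ℝ))
    rw [sub_zero] at this
    refine this.congr fun i => ?_
    rw [Prod.snd_sub]; push_cast; ring
  have h3 := (tendsto_sqrt_mul_heatKernel ht h1).mul (tendsto_sqrt_mul_heatKernel ht h2)
  have e : (2 * √Real.pi)⁻¹ * Real.exp (-(q * y) ^ 2 / 4) *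
      ((2 * √Real.pi)⁻¹ * Real.exp (-(p * y) ^ 2 / 4)) =
      (4 * Real.pi)⁻¹ * Real.exp (-((p : ℝ) ^ 2 + q ^ 2) * y ^ 2 / 4) := by
    have h4 : √Real.pi * √Real.pi = Real.pi := Real.mul_self_sqrt hpi.le
    rw [mul_mul_mul_comm, ← mul_inv, ← Real.exp_add,
      show 2 * √Real.pi * (2 * √Real.pi) = 4 * (√Real.pi * √Real.pi) by ring, h4]
    ring_nf
  rw [e] at h3
  refine h3.congr' ?_
  filter_upwards [ht.eventually_ge_atTop 0] with i hi
  have hst : √(t i) * √(t i) = t i := Real.mul_self_sqrt hi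
  rw [planeHeatKernel, mul_mul_mul_comm, hst]

/-- The point has first coordinate m ≈ qy√(μ/h), so the parabola height b·h·m² tends to bμq²y². As
this limit differs from k, the side of the parabola is eventually settled, and the point eventually
enters the square. -/
lemma eventually_localDefect_linePoint {b c μ : ℝ} {U : ℝ → ℤ × ℤ → ℝ} (hc : 0 < c) (hμ : 0 < μ)
    (hU : ∀ h, 0 < h → IsParabolicDatum p q b c h (U h)) (n k : ℕ) {y : ℝ}
    (hy : b * μ * q ^ 2 * y ^ 2 ≠ k) :
    ∀ᶠ h in 𝓝[>] (0 : ℝ), localDefect p q c n h (U h) (linePoint hq hcop ⌊y * √(μ / h)⌋ k) =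
      limitDefect (b * μ * q ^ 2) n k y := by
  have hpos : ∀ᶠ h in 𝓝[>] (0 : ℝ), 0 < h := eventually_mem_nhdsWithin
  have hid : Tendsto (fun h : ℝ => h) (𝓝[>] (0 : ℝ)) (𝓝 0) := tendsto_id.mono_left nhdsWithin_le_nhds
  have ht := tendsto_div_nhdsGT_zero hμ
  have hs : Tendsto (fun h => √(μ / h)) (𝓝[>] (0 : ℝ)) atTop := Real.tendsto_sqrt_atTop.comp ht
  have hx1 := tendsto_linePoint_fst_div hq hcop hs y k
  have hx2 := tendsto_linePoint_snd_div hq hcop hs y k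
  have hsh : Tendsto (fun h => √(μ / h) * h) (𝓝[>] (0 : ℝ)) (𝓝 0) := by
    have h1 : Tendsto (fun h => √(μ * h)) (𝓝[>] (0 : ℝ)) (𝓝 0) := by
      have := (hid.const_mul μ).sqrt
      simpa using this
    refine h1.congr' ?_
    filter_upwards [hpos] with h hh
    rw [show μ * h = (μ / h) * h ^ 2 by field_simp, Real.sqrt_mul (by positivity),
      Real.sqrt_sq hh.le]
  have hsq1 := (hx1.mul hsh).abs
  have hsq2 := (hx2.mul hsh).abs
  have hpar := (hx1.pow 2).const_mul (b * μ)
  rw [mul_zero, abs_zero] at hsq1 hsq2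
  have hlim : b * μ * (q * y) ^ 2 = b * μ * q ^ 2 * y ^ 2 := by ring
  rw [hlim] at hpar
  have hparab : ∀ h, 0 < h → b * μ * (((linePoint hq hcop ⌊y * √(μ / h)⌋ k).1 : ℝ) / √(μ / h)) ^ 2
      = b * h * ((linePoint hq hcop ⌊y * √(μ / h)⌋ k).1 : ℝ) ^ 2 := by
    intro h hh
    rw [div_pow, Real.sq_sqrt (by positivity)]
    field_simp
  have hins : ∀ᶠ h in 𝓝[>] (0 : ℝ),
      |((linePoint hq hcop ⌊y * √(μ / h)⌋ k).1 : ℝ) * h| < c ∧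
      |((linePoint hq hcop ⌊y * √(μ / h)⌋ k).2 : ℝ) * h| < c := by
    filter_upwards [hpos, hsq1.eventually_lt_const hc, hsq2.eventually_lt_const hc]
      with h hh h1 h2
    have h0 : √(μ / h) ≠ 0 := (Real.sqrt_pos.2 (by positivity)).ne'
    have e : ∀ m : ℝ, m / √(μ / h) * (√(μ / h) * h) = m * h := fun m => by field_simp
    rw [e] at h1 h2
    exact ⟨h1, h2⟩
  rcases lt_or_gt_of_ne hy with hlt | hgt
  · filter_upwards [hpos, hins, hpar.eventually_lt_const hlt] with h hh h1 h2
    rw [hparab h hh] at h2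
    rw [localDefect, if_pos h1, lineIndex_linePoint, limitDefect, if_pos hlt,
      ((hU h hh).2 _ h1.1 h1.2).1 (by rw [lineIndex_linePoint]; exact_mod_cast h2)]
  · filter_upwards [hpos, hins, hpar.eventually_const_lt hgt] with h hh h1 h2
    rw [hparab h hh] at h2
    rw [localDefect, if_pos h1, lineIndex_linePoint, limitDefect, if_neg hgt.not_gt,
      ((hU h hh).2 _ h1.1 h1.2).2 (by rw [lineIndex_linePoint]; exact_mod_cast h2)]

end

end Asymptotics

/-! ### First-order expansion of the semigroup by dominated convergence. -/

noncomputable section MainLimit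

open MeasureTheory AnisoThreshold

/-- Discards the positions where a line meets the limiting parabola, at which the datum is not
determined. -/
lemma ae_forall_mul_sq_ne_natCast {a : ℝ} (ha : 0 < a) :
    ∀ᵐ y : ℝ, ∀ k : ℕ, a * y ^ 2 ≠ k := by
  rw [ae_all_iff]
  intro k
  have hfin : ({√(k / a), -√(k / a)} : Set ℝ).Finite := by simp
  filter_upwards [hfin.countable.ae_notMem volume] with y hy hyk
  apply hy
  have : y ^ 2 = √(k / a) ^ 2 := by
    rw [Real.sq_sqrt (by positivity), ← hyk]
    field_simp
  rcases sq_eq_sq_iff_eq_or_eq_neg.1 this with h | h <;> simp [h]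

/-- All lattice lines meeting the support of the defect at the rescaled position `y` have an index
below this number. -/
def lineCutoff (a : ℝ) (n : ℕ) (y : ℝ) : ℕ := ⌊(n : ℝ) + a * (2 * y ^ 2 + 8)⌋₊ + 1

lemma lt_of_lineCutoff_le {a : ℝ} {n k : ℕ} {y : ℝ} (hk : lineCutoff a n y ≤ k) :
    (n : ℝ) + a * (2 * y ^ 2 + 8) < k :=
  (Nat.lt_floor_add_one _).trans_le (by exact_mod_cast hk)

lemma lineCutoff_le {a : ℝ} (ha : 0 ≤ a) (n : ℕ) (y : ℝ) :
    (lineCutoff a n y : ℝ) ≤ (n + 8 * a + 1) * (1 + y ^ 2) := by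
  have h := Nat.floor_le (show 0 ≤ (n : ℝ) + a * (2 * y ^ 2 + 8) by positivity)
  have hn : 0 ≤ (n : ℝ) * y ^ 2 := by positivity
  have hay : 0 ≤ a * y ^ 2 := by positivity
  have hy := sq_nonneg y
  rw [lineCutoff]
  push_cast
  linarith

section

variable {p q : ℕ} (hq : 0 < q) (hcop : Nat.Coprime p q)

/-- Sort the lattice by lines and replace the position i on the line by ⌊y√t⌋. The change of
variable gives a second √t, so that the integrand carries the full factor t normalizing the planar
kernel. -/
lemma tsum_localDefect_eq_integral {b c h t : ℝ} {u : ℤ × ℤ → ℝ} (ht : 0 < t)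
    (hu : IsParabolicDatum p q b c h u) (n : ℕ) (z₀ : ℤ × ℤ) :
    √t * ∑' z, planeHeatKernel t z * localDefect p q c n h u (z₀ + z) =
      ∫ y : ℝ, t * ∑' k : ℤ, planeHeatKernel t (linePoint hq hcop ⌊y * √t⌋ k - z₀) *
        localDefect p q c n h u (linePoint hq hcop ⌊y * √t⌋ k) := by
  have hs := summable_planeHeatKernel_mul t (f := fun z => localDefect p q c n h u (z₀ + z))
    (fun z => abs_localDefect_le hu n _)
  rw [← (lineEquiv hq hcop z₀).summable_iff] at hs
  have hs1 := hs.prod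
  have hs2 := hs.tsum_prod
  rw [← (lineEquiv hq hcop z₀).tsum_eq]
  simp only [Function.comp_def, lineEquiv_apply, add_sub_cancel] at hs1 hs2 ⊢
  rw [hs2]
  rw [integral_comp_floor_mul hs1 (Real.sqrt_pos.2 ht), ← mul_assoc, Real.mul_self_sqrt ht.le,
    ← integral_const_mul]

lemma tsum_linePoint_eq_sum {b c h μ : ℝ} {u : ℤ × ℤ → ℝ}
    (hu : IsParabolicDatum p q b c h u) (hb : 0 < b) (hh : 0 < h) (ht : 1 ≤ μ / h) (n : ℕ)
    (y : ℝ) (K : ℤ × ℤ → ℝ) :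
    ∑' k : ℤ, K (linePoint hq hcop ⌊y * √(μ / h)⌋ k) *
        localDefect p q c n h u (linePoint hq hcop ⌊y * √(μ / h)⌋ k) =
      ∑ k ∈ Finset.range (lineCutoff (b * μ * q ^ 2) n y),
        K (linePoint hq hcop ⌊y * √(μ / h)⌋ k) *
          localDefect p q c n h u (linePoint hq hcop ⌊y * √(μ / h)⌋ k) := by
  rw [tsum_eq_sum (s := (Finset.range (lineCutoff (b * μ * q ^ 2) n y)).map Nat.castEmbedding)]
  · rw [Finset.sum_map]
    rfl
  · intro k hk
    rw [localDefect_linePoint_eq_zero hq hcop hu hb hh ht n y k, mul_zero]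
    by_contra hcon
    rw [not_or, not_lt] at hcon
    apply hk
    obtain ⟨j, rfl⟩ := Int.eq_ofNat_of_zero_le hcon.1
    rw [Finset.mem_map]
    refine ⟨j, ?_, rfl⟩
    rw [Finset.mem_range]
    by_contra hj
    exact hcon.2 (by simpa using lt_of_lineCutoff_le (not_lt.1 hj))

end

/-- At position y at most O(1 + y²) lines matter, uniformly in h, and each contributes O((1 +
y²)⁻²); this dominates by a multiple of (1 + y²)⁻¹. -/
lemma tendsto_tsum_localDefect {p q : ℕ} (hq : 0 < q) (hcop : Nat.Coprime p q)
    {b c μ : ℝ} {U : ℝ → ℤ × ℤ → ℝ} (hb : 0 < b) (hc : 0 < c) (hμ : 0 < μ)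
    (hU : ∀ h, 0 < h → IsParabolicDatum p q b c h (U h)) (n : ℕ) (z₀ : ℤ × ℤ) :
    Tendsto (fun h => √(μ / h) *
        ∑' z, planeHeatKernel (μ / h) z * localDefect p q c n h (U h) (z₀ + z)) (𝓝[>] (0 : ℝ))
      (𝓝 (∫ y : ℝ, ∑ k ∈ Finset.range (lineCutoff (b * μ * q ^ 2) n y),
        (4 * Real.pi)⁻¹ * Real.exp (-((p : ℝ) ^ 2 + q ^ 2) * y ^ 2 / 4) *
          limitDefect (b * μ * q ^ 2) n k y)) := by
  have hq' : (0 : ℝ) < q := by exact_mod_cast hq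
  set a := b * μ * q ^ 2 with ha
  have ha0 : 0 < a := by positivity
  have ht := tendsto_div_nhdsGT_zero hμ
  have hpos : ∀ᶠ h in 𝓝[>] (0 : ℝ), 0 < h ∧ 1 ≤ μ / h :=
    eventually_mem_nhdsWithin.and (ht.eventually_ge_atTop 1)
  obtain ⟨C, hC, hker⟩ := exists_mul_planeHeatKernel_linePoint_le hq hcop z₀
  have heq : (fun h => ∫ y : ℝ, μ / h * ∑' k : ℤ,
        planeHeatKernel (μ / h) (linePoint hq hcop ⌊y * √(μ / h)⌋ k - z₀) *
        localDefect p q c n h (U h) (linePoint hq hcop ⌊y * √(μ / h)⌋ k)) =ᶠ[𝓝[>] (0 : ℝ)]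
      fun h => √(μ / h) *
        ∑' z, planeHeatKernel (μ / h) z * localDefect p q c n h (U h) (z₀ + z) := by
    filter_upwards [hpos] with h hh
    exact (tsum_localDefect_eq_integral hq hcop (by linarith) (hU h hh.1) n z₀).symm
  refine Tendsto.congr' heq ?_
  refine tendsto_integral_filter_of_dominated_convergence
    (fun y => (n + 8 * a + 1) * C * (1 + y ^ 2)⁻¹) ?_ ?_
    (integrable_inv_one_add_sq.const_mul _) ?_
  · refine Eventually.of_forall fun h => Measurable.aestronglyMeasurable ?_
    exact (measurable_from_top (f := fun i : ℤ => μ / h * ∑' k : ℤ,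
      planeHeatKernel (μ / h) (linePoint hq hcop i k - z₀) *
        localDefect p q c n h (U h) (linePoint hq hcop i k))).comp
      (Int.measurable_floor.comp (measurable_id.mul_const _))
  · filter_upwards [hpos] with h hh
    refine ae_of_all _ fun y => ?_
    rw [tsum_linePoint_eq_sum hq hcop (hU h hh.1) hb hh.1 hh.2 n y
      (fun z => planeHeatKernel (μ / h) (z - z₀)), Finset.mul_sum]
    calc _ ≤ ∑ k ∈ Finset.range (lineCutoff a n y), C * ((1 + y ^ 2)⁻¹) ^ 2 := by
          refine norm_sum_le_of_le _ fun k _ => ?_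
          rw [norm_mul, norm_mul, Real.norm_eq_abs, Real.norm_eq_abs, Real.norm_eq_abs,
            abs_of_pos (by linarith [hh.2] : 0 < μ / h), ← mul_assoc]
          have h1 := hker (μ / h) hh.2 y k
          have h2 := abs_localDefect_le (hU h hh.1) n (linePoint hq hcop ⌊y * √(μ / h)⌋ k)
          exact (mul_le_mul h1 h2 (abs_nonneg _) (by positivity)).trans (mul_one _).le
      _ = lineCutoff a n y * (C * ((1 + y ^ 2)⁻¹) ^ 2) := by simp
      _ ≤ (n + 8 * a + 1) * (1 + y ^ 2) * (C * ((1 + y ^ 2)⁻¹) ^ 2) := by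
          gcongr
          exact lineCutoff_le ha0.le n y
      _ = _ := by
          have : 1 + y ^ 2 ≠ 0 := by positivity
          field_simp
  · filter_upwards [ae_forall_mul_sq_ne_natCast ha0] with y hy
    have hsum : Tendsto (fun h => ∑ k ∈ Finset.range (lineCutoff a n y),
        (μ / h * planeHeatKernel (μ / h) (linePoint hq hcop ⌊y * √(μ / h)⌋ k - z₀)) *
          localDefect p q c n h (U h) (linePoint hq hcop ⌊y * √(μ / h)⌋ k)) (𝓝[>] (0 : ℝ))
        (𝓝 (∑ k ∈ Finset.range (lineCutoff a n y),
        (4 * Real.pi)⁻¹ * Real.exp (-((p : ℝ) ^ 2 + q ^ 2) * y ^ 2 / 4) *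
          limitDefect a n k y)) := by
      refine tendsto_finsetSum _ fun k _ => ?_
      refine (tendsto_mul_planeHeatKernel_linePoint hq hcop ht z₀ y k).mul ?_
      exact tendsto_const_nhds.congr'
        ((eventually_localDefect_linePoint hq hcop hc hμ hU n k (hy k)).mono fun h hh => hh.symm)
    refine hsum.congr' ?_
    filter_upwards [hpos] with h hh
    rw [tsum_linePoint_eq_sum hq hcop (hU h hh.1) hb hh.1 hh.2 n y
      (fun z => planeHeatKernel (μ / h) (z - z₀)), Finset.mul_sum]
    exact Finset.sum_congr rfl fun k _ => mul_assoc _ _ _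

/-- First-order asymptotics of the heat semigroup near a parabolic boundary. -/
theorem tendsto_sqrt_mul_heatSemigroup_sub_half {p q : ℕ} (hq : 0 < q)
    (hcop : Nat.Coprime p q) {b c μ : ℝ} {U : ℝ → ℤ × ℤ → ℝ} (hb : 0 < b) (hc : 0 < c)
    (hμ : 0 < μ) (hU : ∀ h, 0 < h → IsParabolicDatum p q b c h (U h)) {n : ℕ} {z₀ : ℤ × ℤ}
    (hz₀ : lineIndex p q z₀ = n) :
    Tendsto (fun h => √(μ / h) * (heatSemigroup (μ / h) (U h) z₀ - 1 / 2)) (𝓝[>] (0 : ℝ))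
      (𝓝 (∫ y : ℝ, ∑ k ∈ Finset.range (lineCutoff (b * μ * q ^ 2) n y),
        (4 * Real.pi)⁻¹ * Real.exp (-((p : ℝ) ^ 2 + q ^ 2) * y ^ 2 / 4) *
          limitDefect (b * μ * q ^ 2) n k y)) := by
  set rest : ℝ → ℤ × ℤ → ℝ := fun h z =>
    U h (z₀ + z) - heaviside (lineIndex p q z) - localDefect p q c n h (U h) (z₀ + z) with hrest
  have hsplit : ∀ h z, rest h z =
      if |((z₀ + z).1 : ℝ) * h| < c ∧ |((z₀ + z).2 : ℝ) * h| < c then 0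
      else U h (z₀ + z) - heaviside (lineIndex p q z) := by
    intro h z
    have e : lineIndex p q (z₀ + z) - n = lineIndex p q z := by
      rw [← hz₀, ← lineIndex_sub, add_sub_cancel_left]
    rw [hrest]
    simp only [localDefect, e]
    split_ifs <;> ring
  have hrest1 : ∀ h, 0 < h → ∀ z, |rest h z| ≤ 1 := by
    intro h hh z
    rw [hsplit]
    split_ifs
    · simp
    · exact abs_sub_heaviside_le ((hU h hh).1 _) _
  have hpos : ∀ᶠ h in 𝓝[>] (0 : ℝ), 0 < h ∧ 1 ≤ μ / h :=
    eventually_mem_nhdsWithin.and ((tendsto_div_nhdsGT_zero hμ).eventually_ge_atTop 1)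
  have hid : Tendsto (fun h : ℝ => h) (𝓝[>] (0 : ℝ)) (𝓝 0) := tendsto_id.mono_left nhdsWithin_le_nhds
  have hsmall : ∀ m : ℤ, ∀ᶠ h in 𝓝[>] (0 : ℝ), |(m : ℝ) * h| < c / 2 := by
    intro m
    have := (hid.const_mul (m : ℝ)).abs
    rw [mul_zero, abs_zero] at this
    exact this.eventually_lt_const (by positivity)
  obtain ⟨C, hC, htail⟩ := exists_planeHeatKernel_tail_bound
  -- With ρ = c/(2h) the far-field mass is O(t/ρ²) = O(h), hence O(√h) after multiplication by
  -- √(μ/h). Half the side is given up to absorb the shift by z₀.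
  have hrest0 : Tendsto (fun h => √(μ / h) * ∑' z, planeHeatKernel (μ / h) z * rest h z)
      (𝓝[>] (0 : ℝ)) (𝓝 0) := by
    have hlim : Tendsto (fun h => C * (4 * μ / c ^ 2) * √(μ * h)) (𝓝[>] (0 : ℝ)) (𝓝 0) := by
      have := ((hid.const_mul μ).sqrt).const_mul (C * (4 * μ / c ^ 2))
      simpa using this
    refine squeeze_zero_norm' ?_ hlim
    filter_upwards [hpos, hsmall z₀.1, hsmall z₀.2] with h hh h1 h2
    have hh0 := hh.1
    have key := htail (μ / h) hh.2 (c / 2 / h) (by positivity) (rest h) (hrest1 h hh.1) (by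
      intro z hz1 hz2
      rw [lt_div_iff₀ hh.1, ← abs_of_pos hh.1, ← abs_mul] at hz1 hz2
      rw [hsplit, if_pos]
      constructor
      · rw [Prod.fst_add, Int.cast_add, add_mul]
        exact (abs_add_le _ _).trans_lt (by linarith)
      · rw [Prod.snd_add, Int.cast_add, add_mul]
        exact (abs_add_le _ _).trans_lt (by linarith))
    rw [norm_mul, Real.norm_eq_abs, Real.norm_eq_abs, abs_of_nonneg (Real.sqrt_nonneg _)]
    have e : √(μ / h) * h = √(μ * h) := by
      rw [show μ * h = (μ / h) * h ^ 2 by field_simp, Real.sqrt_mul (by positivity),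
        Real.sqrt_sq hh.1.le]
    calc _ ≤ √(μ / h) * (C * (μ / h / (c / 2 / h) ^ 2)) := by gcongr
      _ = C * (4 * μ / c ^ 2) * (√(μ / h) * h) := by field_simp; ring
      _ = _ := by rw [e]
  have hmain := (tendsto_tsum_localDefect hq hcop hb hc hμ hU n z₀).add hrest0
  rw [add_zero] at hmain
  refine hmain.congr' ?_
  filter_upwards [hpos] with h hh
  have hu := hU h hh.1
  have s1 := summable_planeHeatKernel_mul (μ / h)
    (f := fun z => localDefect p q c n h (U h) (z₀ + z)) (fun z => abs_localDefect_le hu n _)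
  have s2 := summable_planeHeatKernel_mul (μ / h) (hrest1 h hh.1)
  have s3 := summable_planeHeatKernel_mul (μ / h) (f := fun z => U h (z₀ + z)) (B := 1)
    (fun z => by rw [abs_of_nonneg (hu.1 _).1]; exact (hu.1 _).2)
  have s4 := summable_planeHeatKernel_mul (μ / h) (f := fun z => heaviside (lineIndex p q z))
    (B := 1) (fun z => by rw [abs_of_nonneg (heaviside_nonneg _)]; exact heaviside_le_one _)
  rw [← mul_add, ← Summable.tsum_add s1 s2, heatSemigroup,
    ← tsum_planeHeatKernel_mul_heaviside p q (by linarith : 0 ≤ μ / h), ← Summable.tsum_sub s3 s4]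
  congr 1
  refine tsum_congr fun z => ?_
  rw [hrest]
  ring

end MainLimit

/-! ### Evaluation of the limit in terms of the two sides of the criterion. -/

noncomputable section GaussianIntegrals

open MeasureTheory AnisoThreshold

lemma integrable_exp_neg_sq_div_four : Integrable fun x : ℝ => Real.exp (-x ^ 2 / 4) :=
  (integrable_exp_neg_mul_sq (b := 1 / 4) (by norm_num)).congr
    (ae_of_all _ fun x => by simp only; ring_nf)

lemma gaussInner_add_gaussOuter (μ κ d : ℝ) :
    gaussInner μ κ d + gaussOuter μ κ d = ∫ x in Ioi (0 : ℝ), Real.exp (-x ^ 2 / 4) :=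
  intervalIntegral.integral_interval_add_Ioi integrable_exp_neg_sq_div_four.integrableOn
    integrable_exp_neg_sq_div_four.integrableOn

lemma gaussInner_pos {μ κ d : ℝ} (h : 0 < 2 * d / (μ * κ)) : 0 < gaussInner μ κ d :=
  intervalIntegral.intervalIntegral_pos_of_pos
    integrable_exp_neg_sq_div_four.intervalIntegrable (fun _ => Real.exp_pos _) (Real.sqrt_pos.2 h)

lemma gaussInner_zero (μ κ : ℝ) : gaussInner μ κ 0 = 0 := by
  simp [gaussInner, gaussLimit]

lemma gaussInner_nonneg (μ κ d : ℝ) : 0 ≤ gaussInner μ κ d :=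
  intervalIntegral.integral_nonneg (Real.sqrt_nonneg _) fun _ _ => (Real.exp_pos _).le

lemma gaussOuter_nonneg (μ κ d : ℝ) : 0 ≤ gaussOuter μ κ d :=
  integral_nonneg fun _ => (Real.exp_pos _).le

/-- Split −x²/4 into two halves and bound one by its value at the lower limit; the resulting
exponential decay in d makes the outer series converge. -/
lemma gaussOuter_le (μ κ d : ℝ) (h : 0 ≤ 2 * d / (μ * κ)) :
    gaussOuter μ κ d ≤
      Real.exp (-(2 * d / (μ * κ)) / 8) * ∫ x : ℝ, Real.exp (-(1 / 8) * x ^ 2) := by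
  have hi := (integrable_exp_neg_mul_sq (b := 1 / 8) (by norm_num)).const_mul
    (Real.exp (-(2 * d / (μ * κ)) / 8))
  rw [← integral_const_mul]
  refine (setIntegral_mono_on integrable_exp_neg_sq_div_four.integrableOn hi.integrableOn
    measurableSet_Ioi fun x hx => ?_).trans
      (setIntegral_le_integral hi (ae_of_all _ fun x => by positivity))
  rw [← Real.exp_add]
  apply Real.exp_le_exp.2
  have h1 : 2 * d / (μ * κ) ≤ x ^ 2 := by
    rw [← Real.sq_sqrt h]
    exact pow_le_pow_left₀ (Real.sqrt_nonneg _) (le_of_lt hx) 2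
  linarith

lemma summable_gaussOuter {μ κ ℓ : ℝ} (hμ : 0 < μ) (hκ : 0 < κ) (hℓ : 0 < ℓ) :
    Summable fun k : ℕ => gaussOuter μ κ (k / ℓ) := by
  have hs : Summable fun k : ℕ => Real.exp (k * (-(1 / (4 * ℓ * μ * κ)))) :=
    Real.summable_exp_nat_mul_iff.2 (by rw [neg_lt_zero]; positivity)
  refine (hs.mul_right (∫ x : ℝ, Real.exp (-(1 / 8) * x ^ 2))).of_nonneg_of_le
    (fun k => gaussOuter_nonneg _ _ _) fun k => ?_
  refine (gaussOuter_le μ κ (k / ℓ) (by positivity)).trans (le_of_eq ?_)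
  congr 2
  field_simp
  ring

/-- Integral of the transverse Gaussian profile over the part of a lattice line inside the
parabola. -/
lemma integral_gaussian_mul_indicator {μ κ ℓ a d : ℝ} (hℓ : 0 < ℓ) (ha : 0 < a) {k : ℝ}
    (hk : 0 ≤ k) (hd : 2 * d / (μ * κ) = ℓ ^ 2 * (k / a)) :
    ∫ y : ℝ, (4 * Real.pi)⁻¹ * Real.exp (-ℓ ^ 2 * y ^ 2 / 4) * (if a * y ^ 2 < k then 1 else 0) =
      (2 * Real.pi * ℓ)⁻¹ * gaussInner μ κ d := by
  have hpi := Real.pi_pos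
  set r := gaussLimit μ κ d with hr
  have hr0 : 0 ≤ r := Real.sqrt_nonneg _
  have hr2 : r ^ 2 = ℓ ^ 2 * (k / a) := by
    rw [hr, gaussLimit, Real.sq_sqrt (by rw [hd]; positivity), hd]
  set f : ℝ → ℝ := fun x => (4 * Real.pi)⁻¹ * indicator (Iio r) (fun x => Real.exp (-x ^ 2 / 4)) x
    with hf
  have e : ∀ y : ℝ, (4 * Real.pi)⁻¹ * Real.exp (-ℓ ^ 2 * y ^ 2 / 4) *
      (if a * y ^ 2 < k then 1 else 0) = f |ℓ * y| := by
    intro y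
    have hiff : a * y ^ 2 < k ↔ |ℓ * y| ∈ Iio r := by
      have habs : |ℓ * y| < r ↔ (ℓ * y) ^ 2 < r ^ 2 := by rw [sq_lt_sq, abs_of_nonneg hr0]
      rw [mem_Iio, habs, hr2, mul_pow, mul_lt_mul_iff_right₀ (by positivity), lt_div_iff₀ ha, mul_comm]
    have e2 : -|ℓ * y| ^ 2 / 4 = -ℓ ^ 2 * y ^ 2 / 4 := by rw [sq_abs]; ring
    by_cases h : a * y ^ 2 < k
    · simp only [hf, if_pos h, indicator_of_mem (hiff.1 h), e2, mul_one]
    · simp only [hf, if_neg h, indicator_of_notMem (fun h' => h (hiff.2 h')), mul_zero]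
  simp_rw [e]
  rw [Measure.integral_comp_mul_left (fun x => f |x|), integral_comp_abs, hf, integral_const_mul,
    setIntegral_indicator measurableSet_Iio, Ioi_inter_Iio, ← integral_Ioc_eq_integral_Ioo,
    ← intervalIntegral.integral_of_le hr0, abs_of_pos (by positivity), smul_eq_mul, gaussInner,
    ← hr]
  field_simp
  norm_num

lemma integral_gaussian_profile {ℓ : ℝ} (hℓ : 0 < ℓ) :
    ∫ y : ℝ, (4 * Real.pi)⁻¹ * Real.exp (-ℓ ^ 2 * y ^ 2 / 4) =
      (2 * Real.pi * ℓ)⁻¹ * ∫ x in Ioi (0 : ℝ), Real.exp (-x ^ 2 / 4) := by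
  have hpi := Real.pi_pos
  have e : ∀ y : ℝ, Real.exp (-ℓ ^ 2 * y ^ 2 / 4) = Real.exp (-|ℓ * y| ^ 2 / 4) := by
    intro y; rw [sq_abs]; ring_nf
  simp_rw [e]
  rw [integral_const_mul, Measure.integral_comp_mul_left (fun x => Real.exp (-|x| ^ 2 / 4)),
    integral_comp_abs (f := fun x => Real.exp (-x ^ 2 / 4)), abs_of_pos (by positivity),
    smul_eq_mul]
  field_simp
  norm_num

lemma integrable_gaussian_profile {ℓ : ℝ} (hℓ : 0 < ℓ) :
    Integrable fun y : ℝ => (4 * Real.pi)⁻¹ * Real.exp (-ℓ ^ 2 * y ^ 2 / 4) :=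
  ((integrable_exp_neg_mul_sq (b := ℓ ^ 2 / 4) (by positivity)).const_mul (4 * Real.pi)⁻¹).congr
    (ae_of_all _ fun x => by simp only; ring_nf)

lemma innerSum_eq {μ κ : ℝ} {d : ℕ → ℝ} (hd0 : d 0 = 0) (n : ℕ) :
    innerSum μ κ d n =
      ∑ k ∈ Finset.range n, gaussInner μ κ (d k) + 1 / 2 * gaussInner μ κ (d n) := by
  rw [innerSum, add_comm]
  congr 1
  cases n with
  | zero => simp
  | succ n =>
    rw [Finset.range_eq_Ico, Finset.sum_eq_sum_Ico_succ_bot (Nat.succ_pos n), hd0,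
      gaussInner_zero, zero_add]

/-- The step from n to n + 1 adds half of the inner and outer integrals at both indices, and the
inner integral at n + 1 is positive. -/
lemma innerSum_sub_outerSum_strictMono {μ κ ℓ : ℝ} (hμ : 0 < μ) (hκ : 0 < κ) (hℓ : 0 < ℓ)
    {d : ℕ → ℝ} (hd : ∀ k : ℕ, d k = k / ℓ) :
    StrictMono fun n => innerSum μ κ d n - outerSum μ κ d n := by
  have hs : Summable fun k : ℕ => gaussOuter μ κ (d k) := by
    exact (summable_gaussOuter hμ hκ hℓ).congr fun k => by rw [hd]
  refine strictMono_nat_of_lt_succ fun n => ?_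
  have hpos : 0 < gaussInner μ κ (d (n + 1)) := by
    apply gaussInner_pos
    rw [hd]
    push_cast
    positivity
  have h1 := gaussInner_nonneg μ κ (d n)
  have h2 := gaussOuter_nonneg μ κ (d n)
  have h3 := gaussOuter_nonneg μ κ (d (n + 1))
  have hs1 : Summable fun k : ℕ => gaussOuter μ κ (d (n + 1 + k)) :=
    ((summable_nat_add_iff (n + 1)).2 hs).congr fun k => by rw [add_comm]
  have h4 := hs1.tsum_eq_zero_add
  rw [add_zero] at h4
  have e : ∑' k : ℕ, gaussOuter μ κ (d (n + 1 + (k + 1))) =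
      ∑' k : ℕ, gaussOuter μ κ (d (n + 1 + 1 + k)) :=
    tsum_congr fun k => by rw [show n + 1 + (k + 1) = n + 1 + 1 + k by ring]
  rw [e] at h4
  have hd0 : d 0 = 0 := by rw [hd]; simp
  rw [innerSum_eq hd0, innerSum_eq hd0, outerSum, outerSum, h4,
    Finset.sum_range_succ]
  linarith

/-- The first-order coefficient of the heat semigroup is the difference of the two sides of the
criterion. -/
lemma integral_sum_limitDefect {μ κ ℓ a : ℝ} (hμ : 0 < μ) (hκ : 0 < κ) (hℓ : 0 < ℓ)
    (ha : a = κ * μ * ℓ ^ 3 / 2) {d : ℕ → ℝ} (hd : ∀ k : ℕ, d k = k / ℓ) (n : ℕ) :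
    ∫ y : ℝ, ∑ k ∈ Finset.range (lineCutoff a n y),
        (4 * Real.pi)⁻¹ * Real.exp (-ℓ ^ 2 * y ^ 2 / 4) * limitDefect a n k y =
      (2 * Real.pi * ℓ)⁻¹ * (innerSum μ κ d n - outerSum μ κ d n) := by
  have hpi := Real.pi_pos
  have ha0 : 0 < a := by rw [ha]; positivity
  set g : ℝ → ℝ := fun y => (4 * Real.pi)⁻¹ * Real.exp (-ℓ ^ 2 * y ^ 2 / 4) with hg
  have hg0 : ∀ y, 0 ≤ g y := fun y => by positivity
  set F : ℕ → ℝ → ℝ := fun k y => g y * limitDefect a n k y with hF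
  set I : ℕ → ℝ := fun k => gaussInner μ κ (d k)
  set O : ℕ → ℝ := fun k => gaussOuter μ κ (d k)
  set Γ : ℝ := ∫ x in Ioi (0 : ℝ), Real.exp (-x ^ 2 / 4)
  have hadd : ∀ k, I k + O k = Γ := fun k => gaussInner_add_gaussOuter _ _ _
  have hgi : Integrable g := integrable_gaussian_profile hℓ
  have hind : ∀ k : ℕ, Integrable fun y => g y * (if a * y ^ 2 < k then 1 else 0) := by
    intro k
    refine hgi.mono' ?_ (ae_of_all _ fun y => ?_)
    · exact Measurable.aestronglyMeasurable (Measurable.mul (by fun_prop)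
        (Measurable.ite (measurableSet_lt (by fun_prop) measurable_const)
          measurable_const measurable_const))
    · rw [norm_mul, Real.norm_of_nonneg (hg0 y)]
      split_ifs <;> simp [hg0 y]
  have hFe : ∀ k, F k = fun y => g y * (if a * y ^ 2 < k then 1 else 0) -
      g y * heaviside ((k : ℤ) - n) := by
    intro k
    funext y
    simp only [hF, limitDefect]
    ring
  have hFi : ∀ k, Integrable (F k) := fun k => by
    rw [hFe]; exact (hind k).sub (hgi.mul_const _)
  have hint : ∀ k, ∫ y, F k y = (2 * Real.pi * ℓ)⁻¹ * (I k - heaviside ((k : ℤ) - n) * Γ) := by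
    intro k
    rw [hFe, integral_sub (hind k) (hgi.mul_const _), integral_mul_const,
      integral_gaussian_mul_indicator hℓ ha0 (Nat.cast_nonneg k) (μ := μ) (κ := κ) (d := d k),
      integral_gaussian_profile hℓ]
    · ring
    -- The curvature enters here: a = κμℓ³/2 and d_k = k/ℓ give ℓ²k/a = 2d_k/(μκ).
    · rw [hd, ha]; field_simp
  have htail : ∀ k, n < k → ∫ y, F k y = -((2 * Real.pi * ℓ)⁻¹ * O k) := by
    intro k hk
    rw [hint, heaviside, if_pos (by omega), ← hadd k]
    ring
  have hO : Summable O := by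
    simp only [O, hd]; exact summable_gaussOuter hμ hκ hℓ
  -- For k > n the integrand is nonpositive, so its L¹ norm is a multiple of an outer Gaussian
  -- integral; this justifies exchanging sum and integral.
  have hnorm : Summable fun k => ∫ y, ‖F k y‖ := by
    rw [← summable_nat_add_iff (n + 1)]
    refine (((summable_nat_add_iff (n + 1)).2 hO).mul_left (2 * Real.pi * ℓ)⁻¹).congr fun k => ?_
    have hneg : ∀ y, ‖F (k + (n + 1)) y‖ = -F (k + (n + 1)) y := by
      intro y
      rw [Real.norm_eq_abs, abs_of_nonpos]
      refine mul_nonpos_of_nonneg_of_nonpos (hg0 y) ?_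
      have hk : heaviside (((k + (n + 1) : ℕ) : ℤ) - n) = 1 := if_pos (by push_cast; omega)
      rw [limitDefect, hk]
      split_ifs <;> norm_num
    simp_rw [hneg]
    rw [integral_neg, htail _ (by omega), neg_neg]
  have hsum := hasSum_integral_of_summable_integral_norm hFi hnorm
  have htsum : ∀ y, ∑' k, F k y = ∑ k ∈ Finset.range (lineCutoff a n y), F k y := by
    intro y
    refine tsum_eq_sum fun k hk => ?_
    have h := lt_of_lineCutoff_le (not_lt.1 (fun h => hk (Finset.mem_range.2 h)))
    have hay : 0 ≤ a * y ^ 2 := by positivity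
    have hn : (0 : ℝ) ≤ n := n.cast_nonneg
    have h1 : a * y ^ 2 < k := by linarith
    have h2 : (n : ℝ) < k := by linarith
    rw [Nat.cast_lt] at h2
    simp only [hF, limitDefect, if_pos h1, heaviside]
    rw [if_pos (by omega), sub_self, mul_zero]
  simp_rw [htsum] at hsum
  rw [← hsum.tsum_eq, ← hsum.summable.sum_add_tsum_nat_add (n + 1)]
  have e1 : ∀ k : ℕ, ∫ y, F (k + (n + 1)) y = -((2 * Real.pi * ℓ)⁻¹ * O (n + 1 + k)) := fun k => by
    rw [htail _ (by omega), add_comm]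
  have e2 : ∑ k ∈ Finset.range n, ∫ y, F k y =
      (2 * Real.pi * ℓ)⁻¹ * ∑ k ∈ Finset.range n, I k := by
    rw [Finset.mul_sum]
    refine Finset.sum_congr rfl fun k hk => ?_
    have := Finset.mem_range.1 hk
    rw [hint, heaviside, if_neg (by omega), if_neg (by omega), zero_mul, sub_zero]
  have e3 : ∫ y, F n y = (2 * Real.pi * ℓ)⁻¹ * (1 / 2 * I n - 1 / 2 * O n) := by
    rw [hint, heaviside, if_neg (by omega), if_pos (by omega), ← hadd n]
    ring
  have hd0 : d 0 = 0 := by rw [hd]; simp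
  simp_rw [e1]
  rw [Finset.sum_range_succ, e2, e3, tsum_neg, tsum_mul_left, innerSum_eq hd0, outerSum]
  ring

end GaussianIntegrals

/-! ### Distance to the tangent and uniqueness of the passage index. -/

noncomputable section NormalDisplacement

open AnisoThreshold

lemma infDist_tangentLine {p q : ℕ} (hq : 0 < q) (x : Plane) :
    Metric.infDist x (tangentLine p q) =
      |(q : ℝ) * x 1 - p * x 0| / √((p : ℝ) ^ 2 + (q : ℝ) ^ 2) := by
  have hq' : (0 : ℝ) < q := by exact_mod_cast hq
  set m : ℝ := (p : ℝ) ^ 2 + (q : ℝ) ^ 2 with hm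
  have hm0 : 0 < m := by positivity
  have hℓ : 0 < √m := Real.sqrt_pos.2 hm0
  set δ : ℝ := (q * x 1 - p * x 0) / m with hδ
  have hmem : !₂[x 0 + p * δ, x 1 - q * δ] ∈ tangentLine p q := by
    change x 1 - q * δ = (p : ℝ) / q * (x 0 + p * δ)
    rw [hδ, hm]
    field_simp
    ring
  apply le_antisymm
  · refine (Metric.infDist_le_dist_of_mem hmem).trans (le_of_eq ?_)
    rw [EuclideanSpace.dist_eq, Fin.sum_univ_two, Real.dist_eq, Real.dist_eq, sq_abs, sq_abs]
    change √((x 0 - (x 0 + p * δ)) ^ 2 + (x 1 - (x 1 - q * δ)) ^ 2) = _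
    have e : (x 0 - (x 0 + p * δ)) ^ 2 + (x 1 - (x 1 - q * δ)) ^ 2 =
        ((q * x 1 - p * x 0) / √m) ^ 2 := by
      rw [div_pow, Real.sq_sqrt hm0.le]
      have : (x 0 - (x 0 + p * δ)) ^ 2 + (x 1 - (x 1 - q * δ)) ^ 2 = m * δ ^ 2 := by
        rw [hm]; ring
      rw [this, hδ]
      field_simp
    rw [e, Real.sqrt_sq_eq_abs, abs_div, abs_of_pos hℓ]
  · refine (Metric.le_infDist ⟨_, hmem⟩).2 fun y hy => ?_
    have hy' : (q : ℝ) * y 1 = p * y 0 := by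
      have : y 1 = (p : ℝ) / q * y 0 := hy
      rw [this]; field_simp
    rw [div_le_iff₀ hℓ, EuclideanSpace.dist_eq, Fin.sum_univ_two, Real.dist_eq, Real.dist_eq,
      sq_abs, sq_abs, ← Real.sqrt_mul (by positivity)]
    apply Real.abs_le_sqrt
    have e : (q : ℝ) * x 1 - p * x 0 = q * (x 1 - y 1) - p * (x 0 - y 0) := by
      linear_combination hy'
    rw [e, hm]
    -- Cauchy–Schwarz; the hinted square is the defect in Lagrange's identity.
    nlinarith [sq_nonneg (p * (x 1 - y 1) + q * (x 0 - y 0))]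

lemma infDist_gridPoint_tangentLine {p q : ℕ} (hq : 0 < q) {h : ℝ} (hh : 0 < h) (z : ℤ × ℤ) :
    Metric.infDist (gridPoint h z) (tangentLine p q) = lineDist p q z * h := by
  rw [infDist_tangentLine hq, lineDist]
  change |(q : ℝ) * (z.2 * h) - p * (z.1 * h)| / _ = _
  have e : (q : ℝ) * (z.2 * h) - p * (z.1 * h) = (z.2 * q - z.1 * p) * h := by ring
  rw [e, abs_mul, abs_of_pos hh]
  ring

lemma isNormalDisplacement_iff {p q : ℕ} (hq : 0 < q) {P : ℕ → ℤ × ℤ} {h : ℝ} (hh : 0 < h)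
    {W : ℤ × ℤ → ℝ} {n : ℕ} (h1 : ∀ i ≤ n, W (P i) ≤ 1 / 2) (h2 : 1 / 2 < W (P (n + 1))) (D : ℝ) :
    IsNormalDisplacement p q P h W D ↔ D = lineDist p q (P n) * h := by
  constructor
  · rintro ⟨m, hm1, hm2, rfl⟩
    obtain rfl : m = n := by
      rcases lt_trichotomy m n with hlt | heq | hgt
      · exact absurd (h1 (m + 1) hlt) (not_le.2 hm2)
      · exact heq
      · exact absurd (hm1 (n + 1) hgt) (not_le.2 h2)
    exact infDist_gridPoint_tangentLine hq hh _
  · rintro rfl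
    exact ⟨n, h1, h2, (infDist_gridPoint_tangentLine hq hh _).symm⟩

end NormalDisplacement

/-! ### From the geometric datum to the threshold criterion. -/

noncomputable section Threshold

open AnisoThreshold

lemma initialDatum_mem_Icc (Ω : Set Plane) (h : ℝ) (z : ℤ × ℤ) :
    0 ≤ initialDatum Ω h z ∧ initialDatum Ω h z ≤ 1 := by
  classical
  rw [initialDatum, indicator_apply]
  split_ifs <;> norm_num

lemma isParabolicDatum_initialDatum {p q : ℕ} (hq : 0 < q) {κ c h : ℝ} {Ω : Set Plane}
    (hΩ : ∀ x y : ℝ, |x| < c → |y| < c →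
      (y < boundaryGraph p q κ x → !₂[x, y] ∈ Ω) ∧ (boundaryGraph p q κ x < y → !₂[x, y] ∉ Ω))
    (hh : 0 < h) :
    IsParabolicDatum p q
      (κ * ((q : ℝ) ^ 2 + (p : ℝ) ^ 2) ^ (3 / 2 : ℝ) / (2 * (q : ℝ) ^ 3) * q) c h
      (initialDatum Ω h) := by
  have hq' : (0 : ℝ) < q := by exact_mod_cast hq
  refine ⟨initialDatum_mem_Icc Ω h, fun z h1 h2 => ?_⟩
  set v := κ * ((q : ℝ) ^ 2 + (p : ℝ) ^ 2) ^ (3 / 2 : ℝ) / (2 * (q : ℝ) ^ 3) with hv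
  -- At grid points the vertical gap to the graph is a positive multiple of the line index minus
  -- b·h·m², with b = v₀q.
  have e : boundaryGraph p q κ (z.1 * h) - z.2 * h =
      h / q * (lineIndex p q z - v * q * h * (z.1 : ℝ) ^ 2) := by
    rw [boundaryGraph, ← hv, lineIndex]
    push_cast
    field_simp
    ring
  have hhq : 0 < h / q := by positivity
  obtain ⟨hin, hout⟩ := hΩ (z.1 * h) (z.2 * h) h1 h2
  constructor
  · intro hlt
    have : 0 < h / q * (lineIndex p q z - v * q * h * (z.1 : ℝ) ^ 2) :=
      mul_pos hhq (by linarith)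
    exact indicator_of_mem (show z ∈ latticeSet Ω h from hin (by linarith)) _
  · intro hlt
    have : h / q * (lineIndex p q z - v * q * h * (z.1 : ℝ) ^ 2) < 0 :=
      mul_neg_of_pos_of_neg hhq (by linarith)
    exact indicator_of_notMem (show z ∉ latticeSet Ω h from hout (by linarith)) _

lemma tendsto_sqrt_mul_threshold {p q : ℕ} (hq : 0 < q) (hcop : Nat.Coprime p q) {κ μ : ℝ}
    (hκ : 0 < κ) (hμ : 0 < μ) {Ω : Set Plane} (hΩ : HasLocalBoundary Ω p q κ)
    {d : ℕ → ℝ} (hd : ∀ k : ℕ, d k = k / √((p : ℝ) ^ 2 + (q : ℝ) ^ 2)) {n : ℕ} {z : ℤ × ℤ}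
    (hz : lineIndex p q z = n) :
    Tendsto (fun h => √(μ / h) * (heatSemigroup (μ / h) (initialDatum Ω h) z - 1 / 2))
      (𝓝[>] (0 : ℝ)) (𝓝 ((2 * Real.pi * √((p : ℝ) ^ 2 + (q : ℝ) ^ 2))⁻¹ *
        (innerSum μ κ d n - outerSum μ κ d n))) := by
  obtain ⟨c, hc, hc'⟩ := hΩ
  have hq' : (0 : ℝ) < q := by exact_mod_cast hq
  have hm0 : 0 < (p : ℝ) ^ 2 + (q : ℝ) ^ 2 := by positivity
  have hℓ : 0 < √((p : ℝ) ^ 2 + (q : ℝ) ^ 2) := Real.sqrt_pos.2 hm0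
  have key := tendsto_sqrt_mul_heatSemigroup_sub_half hq hcop (by positivity) hc hμ
    (fun h hh => isParabolicDatum_initialDatum hq hc' hh) hz
  have hrpow : ∀ m : ℝ, 0 ≤ m → m ^ (3 / 2 : ℝ) = √m ^ 3 := fun m hm => by
    rw [Real.sqrt_eq_rpow, ← Real.rpow_natCast, ← Real.rpow_mul hm]
    norm_num
  have hpow : ((q : ℝ) ^ 2 + (p : ℝ) ^ 2) ^ (3 / 2 : ℝ) = √((p : ℝ) ^ 2 + (q : ℝ) ^ 2) ^ 3 := by
    rw [add_comm, hrpow _ hm0.le]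
  rw [← integral_sum_limitDefect hμ hκ hℓ rfl hd n, Real.sq_sqrt hm0.le]
  convert key using 8
  all_goals rw [hpow]; field_simp

theorem theorem4 (p q : ℕ) (hp : 1 ≤ p) (hpq : p ≤ q) (hcop : Nat.Coprime p q)
    (κ μ : ℝ) (hκ : 0 < κ) (hμ : 0 < μ)
    (Ω : Set AnisoThreshold.Plane) (hΩ : AnisoThreshold.HasLocalBoundary Ω p q κ)
    (P : ℕ → ℤ × ℤ) (hP : AnisoThreshold.IsStripOrdering p q P)
    (d : ℕ → ℝ) (hd : ∀ i, d i = AnisoThreshold.lineDist p q (P i)) (n₀ : ℕ) :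
    Summable (fun k : ℕ => AnisoThreshold.gaussOuter μ κ (d (n₀ + 1 + k))) ∧
    ∀ᶠ h in 𝓝[>] (0 : ℝ), ∀ w : ℝ → ℤ × ℤ → ℝ,
      AnisoThreshold.IsHeatSolution h (μ * h) (AnisoThreshold.initialDatum Ω h) w →
      (w (μ * h) (P n₀) ≤ 1 / 2 →
        AnisoThreshold.innerSum μ κ d n₀ ≤ AnisoThreshold.outerSum μ κ d n₀) ∧
      (AnisoThreshold.innerSum μ κ d n₀ ≠ AnisoThreshold.outerSum μ κ d n₀ →
        (w (μ * h) (P n₀) ≤ 1 / 2 ↔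
          AnisoThreshold.innerSum μ κ d n₀ ≤ AnisoThreshold.outerSum μ κ d n₀)) ∧
      (w (μ * h) (P n₀) = 1 / 2 →
        AnisoThreshold.innerSum μ κ d n₀ = AnisoThreshold.outerSum μ κ d n₀ ∧
        (∀ D : ℝ, AnisoThreshold.IsNormalDisplacement p q P h (w (μ * h)) D ↔ D = d n₀ * h) ∧
        (∀ V : ℝ, AnisoThreshold.IsNormalVelocity p q P h (μ * h) (w (μ * h)) V ↔
          V = d n₀ / μ)) := by
  have hq : 0 < q := by omega
  have hq' : (0 : ℝ) < q := by exact_mod_cast hq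
  set ℓ := √((p : ℝ) ^ 2 + (q : ℝ) ^ 2) with hℓdef
  have hℓ : 0 < ℓ := Real.sqrt_pos.2 (by positivity)
  have hd' : ∀ k : ℕ, d k = k / ℓ := fun k => by rw [hd, lineDist_stripOrdering hq hcop hP]
  have hmono := innerSum_sub_outerSum_strictMono hμ hκ hℓ hd'
  have hcoef : 0 < (2 * Real.pi * ℓ)⁻¹ := by have := Real.pi_pos; positivity
  have hlim := fun i : ℕ => tendsto_sqrt_mul_threshold hq hcop hκ hμ hΩ hd'
    (lineIndex_stripOrdering hq hcop hP i)
  have hpos : ∀ᶠ h in 𝓝[>] (0 : ℝ), 0 < h := eventually_mem_nhdsWithin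
  have hlt : ∀ i, innerSum μ κ d i - outerSum μ κ d i < 0 → ∀ᶠ h in 𝓝[>] (0 : ℝ),
      heatSemigroup (μ / h) (initialDatum Ω h) (P i) < 1 / 2 := by
    intro i hi
    filter_upwards [hpos, (hlim i).eventually_lt_const (mul_neg_of_pos_of_neg hcoef hi)]
      with h hh h1
    have := lt_of_mul_lt_mul_left (h1.trans_eq (mul_zero √(μ / h)).symm) (Real.sqrt_nonneg _)
    linarith
  have hgt : ∀ i, 0 < innerSum μ κ d i - outerSum μ κ d i → ∀ᶠ h in 𝓝[>] (0 : ℝ),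
      1 / 2 < heatSemigroup (μ / h) (initialDatum Ω h) (P i) := by
    intro i hi
    filter_upwards [hpos, (hlim i).eventually_const_lt (mul_pos hcoef hi)] with h hh h1
    have := (mul_pos_iff_of_pos_left (Real.sqrt_pos.2 (by positivity : 0 < μ / h))).1 h1
    linarith
  -- All bounded solutions agree with the semigroup, so the smallness of h can be chosen before w.
  have hrepr : ∀ h, 0 < h → ∀ w, IsHeatSolution h (μ * h) (initialDatum Ω h) w → ∀ z,
      w (μ * h) z = heatSemigroup (μ / h) (initialDatum Ω h) z := by
    intro h hh w hw z
    have hu : ∀ z, |initialDatum Ω h z| ≤ 1 := fun z => by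
      rw [abs_of_nonneg (initialDatum_mem_Icc Ω h z).1]
      exact (initialDatum_mem_Icc Ω h z).2
    rw [eq_heatSemigroup hu hw (by positivity)]
    congr 1
    field_simp
  refine ⟨?_, ?_⟩
  · refine ((summable_nat_add_iff (n₀ + 1)).2 (summable_gaussOuter hμ hκ hℓ)).congr fun k => ?_
    rw [hd', add_comm]
  rcases lt_trichotomy (innerSum μ κ d n₀ - outerSum μ κ d n₀) 0 with hneg | hzero | hposD
  · filter_upwards [hpos, hlt n₀ hneg] with h hh h1 w hw
    rw [← hrepr h hh w hw] at h1
    exact ⟨fun _ => by linarith, fun _ => ⟨fun _ => by linarith, fun _ => h1.le⟩,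
      fun h2 => absurd h2 h1.ne⟩
  -- Balanced case: strict monotonicity forces values below 1/2 at the finitely many indices before
  -- n₀ and above 1/2 at n₀ + 1, so the passage occurs at n₀ as soon as the value there is 1/2.
  · have hbelow : ∀ᶠ h in 𝓝[>] (0 : ℝ), ∀ i ∈ Finset.range n₀,
        heatSemigroup (μ / h) (initialDatum Ω h) (P i) < 1 / 2 := by
      rw [Filter.eventually_all_finset]
      intro i hi
      exact hlt i ((hmono (Finset.mem_range.1 hi)).trans_eq hzero)
    filter_upwards [hpos, hbelow, hgt (n₀ + 1) (hzero.symm.trans_lt (hmono n₀.lt_succ_self))]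
      with h hh h1 h2 w hw
    have hr := hrepr h hh w hw
    have heq : innerSum μ κ d n₀ = outerSum μ κ d n₀ := sub_eq_zero.1 hzero
    refine ⟨fun _ => heq.le, fun hne => absurd heq hne, fun hhalf => ?_⟩
    have hD : ∀ D : ℝ, IsNormalDisplacement p q P h (w (μ * h)) D ↔ D = d n₀ * h := by
      intro D
      rw [hd n₀]
      refine isNormalDisplacement_iff hq hh (fun i hi => ?_) (by rw [hr]; exact h2) D
      rcases hi.lt_or_eq with hi | rfl
      · rw [hr]; exact (h1 i (Finset.mem_range.2 hi)).le
      · exact hhalf.le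
    refine ⟨heq, hD, fun V => ?_⟩
    simp only [IsNormalVelocity, hD, exists_eq_left]
    rw [mul_div_mul_right _ _ hh.ne']
  · filter_upwards [hpos, hgt n₀ hposD] with h hh h1 w hw
    rw [← hrepr h hh w hw] at h1
    exact ⟨fun h2 => absurd h2 (not_le.2 h1), fun _ => ⟨fun h2 => absurd h2 (not_le.2 h1),
      fun h2 => by linarith⟩, fun h2 => absurd h2 h1.ne'⟩

end Threshold
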